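/- Let $n\ge 1$, $1<p<\infty$, $0<s<1$, $\Lambda\ge 1$, and let $\Omega\subset\mathbb{R}^n$ be a bounded domain (a nonempty, open, connected set). Let $K:\mathbb{R}^n\times\mathbb{R}^n\to\mathbb{R}$ be measurable with $K(x,y)=K(y,x)$ for all $x,y$ and $$\frac{\Lambda^{-1}}{|x-y|^{n+ps}}\le K(x,y)\le\frac{\Lambda}{|x-y|^{n+ps}}\qquad\text{for } x\ne y .$$ Write $\Omega'\Subset\Omega$ if $\Omega'$ is open and $\overline{\Omega'}$ is a compact subset of $\Omega$. Let $W^{1,p}(\Omega')$ be the space of functions in $L^p(\Omega')$ with weak gradient in $L^p(\Omega')$, let $W^{1,p}_0(\Omega')$ be the closure of $C_c^\infty(\Omega')$ in $W^{1,p}(\Omega')$, with functions extended by zero to $\mathbb{R}^n$, and write $u\in W^{1,p}_{\mathrm{loc}}(\Omega)$ if $u\in W^{1,p}(\Omega')$ for every $\Omega'\Subset\Omega$. Let $u:\mathbb{R}^n\to\mathbb{R}$ be a weak subsolution of $$-\operatorname{div}(|\nabla u|^{p-2}\nabla u)+\mathrm{P.V.}\int_{\mathbb{R}^n}|u(x)-u(y)|^{p-2}(u(x)-u(y))K(x,y)\,dy=0\quad\text{in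 }\Omega,$$ that is, $u\in L^\infty(\mathbb{R}^n)\cap W^{1,p}_{\mathrm{loc}}(\Omega)$ and, for every $\Omega'\Subset\Omega$ and every nonnegative $\phi\in W^{1,p}_0(\Omega')$, $$\int_{\Omega'}|\nabla u|^{p-2}\nabla u\cdot\nabla\phi\,dx+\int_{\mathbb{R}^n}\int_{\mathbb{R}^n}|u(x)-u(y)|^{p-2}(u(x)-u(y))(\phi(x)-\phi(y))K(x,y)\,dx\,dy\le 0 .$$ Let $B_r(x)$ be the open ball with center $x$ and radius $r$, and let $$\mathcal{F}=\Big\{x\in\Omega:\ \lim_{r\to0}\frac{1}{|B_r(x)|}\int_{B_r(x)}|u(x)-u(y)|\,dy=0\Big\}$$ be the set of Lebesgue points of $u$ in $\Omega$. Then the limit $$u^*(x)=\lim_{r\to 0}\operatorname*{ess\,sup}_{y\in B_r(x)}u(y)$$ exists for every $x\in\Omega$, and $u(x)=u^*(x)$ for every $x\in\mathcal{F}$. In particular, $u^*$ is an upper semicontinuous representative of $u$ in $\Omega$: it is upper semicontinuous in $\Omega$ and $u^*=u$ almost everywhere in $\Omega$. -/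

import Mathlib

open MeasureTheory Filter Topology
open scoped ContDiff

namespace MixedPLaplace

/-- Euclidean space `ℝⁿ` with its Euclidean norm. -/
abbrev Eucl (n : ℕ) : Type := EuclideanSpace ℝ (Fin n)

/-- `Ω' ⋐ Ω`: the closure of `Ω'` is a compact subset of `Ω`. -/
def CompactlyContained {n : ℕ} (Ω' Ω : Set (Eucl n)) : Prop :=
  IsCompact (closure Ω') ∧ closure Ω' ⊆ Ω

/-- `φ ∈ C_c^∞(Ω)`. -/
def IsTestFunction {n : ℕ} (Ω : Set (Eucl n)) (φ : Eucl n → ℝ) : Prop :=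
  ContDiff ℝ ∞ φ ∧ HasCompactSupport φ ∧ tsupport φ ⊆ Ω

/-- `G` is the distributional gradient of `u` in the open set `Ω`: both are locally integrable
in `Ω` and `∫ u ∂_v φ = - ∫ ⟨G, v⟩ φ` for every `φ ∈ C_c^∞(Ω)` and every direction `v`. -/
structure HasWeakGradient {n : ℕ} (Ω : Set (Eucl n)) (u : Eucl n → ℝ)
    (G : Eucl n → Eucl n) : Prop where
  locallyIntegrableOn : LocallyIntegrableOn u Ω
  locallyIntegrableOn_grad : LocallyIntegrableOn G Ω
  integral_eq : ∀ φ : Eucl n → ℝ, IsTestFunction Ω φ → ∀ v : Eucl n,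
    ∫ x in Ω, u x * fderiv ℝ φ x v = - ∫ x in Ω, inner ℝ (G x) v * φ x

/-- `u ∈ W^{1,p}(Ω)`. -/
def MemW1p {n : ℕ} (p : ℝ) (Ω : Set (Eucl n)) (u : Eucl n → ℝ) : Prop :=
  MemLp u (ENNReal.ofReal p) (volume.restrict Ω) ∧
    ∃ G : Eucl n → Eucl n, HasWeakGradient Ω u G ∧
      MemLp G (ENNReal.ofReal p) (volume.restrict Ω)

/-- `u ∈ W^{1,p}_loc(Ω)`. -/
def MemW1pLoc {n : ℕ} (p : ℝ) (Ω : Set (Eucl n)) (u : Eucl n → ℝ) : Prop :=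
  ∀ Ω' : Set (Eucl n), IsOpen Ω' → CompactlyContained Ω' Ω → MemW1p p Ω' u

/-- `φ ∈ W_0^{1,p}(Ω)`, the closure of `C_c^∞(Ω)` in `W^{1,p}(Ω)`; the elements are regarded as
functions on `ℝⁿ` that vanish outside `Ω`. -/
def MemW1pZero {n : ℕ} (p : ℝ) (Ω : Set (Eucl n)) (φ : Eucl n → ℝ) : Prop :=
  (∀ x, x ∉ Ω → φ x = 0) ∧
  MemLp φ (ENNReal.ofReal p) (volume.restrict Ω) ∧
  ∃ G : Eucl n → Eucl n, HasWeakGradient Ω φ G ∧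
    MemLp G (ENNReal.ofReal p) (volume.restrict Ω) ∧
    ∃ ψ : ℕ → Eucl n → ℝ, (∀ k, IsTestFunction Ω (ψ k)) ∧
      Tendsto (fun k => eLpNorm (fun x => ψ k x - φ x) (ENNReal.ofReal p) (volume.restrict Ω))
        atTop (𝓝 0) ∧
      Tendsto (fun k => eLpNorm (fun x => gradient (ψ k) x - G x) (ENNReal.ofReal p)
        (volume.restrict Ω)) atTop (𝓝 0)

/-- `K` is a measurable symmetric kernel comparable to `|x - y|^{-(n+ps)}` off the diagonal, with
constant `Λ`. -/
structure IsKernel {n : ℕ} (p s Λ : ℝ) (K : Eucl n → Eucl n → ℝ) : Prop where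
  measurable : Measurable (Function.uncurry K)
  symm : ∀ x y, K x y = K y x
  lower : ∀ x y, x ≠ y → Λ⁻¹ / ‖x - y‖ ^ ((n : ℝ) + p * s) ≤ K x y
  upper : ∀ x y, x ≠ y → K x y ≤ Λ / ‖x - y‖ ^ ((n : ℝ) + p * s)

/-- Weak subsolution of `-Δ_p u + 𝓛 u = 0` in `Ω`. Here `G` and `H` stand for `∇u` and `∇φ` in
`Ω'`; they exist since `u ∈ W^{1,p}(Ω')` and `φ ∈ W_0^{1,p}(Ω')`, and they are unique up to null
sets, so that quantifying over them is no restriction. -/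
structure IsWeakSubsolution {n : ℕ} (p : ℝ) (K : Eucl n → Eucl n → ℝ) (Ω : Set (Eucl n))
    (u : Eucl n → ℝ) : Prop where
  memLp_top : MemLp u ⊤ (volume : Measure (Eucl n))
  memW1pLoc : MemW1pLoc p Ω u
  le_zero : ∀ Ω' : Set (Eucl n), IsOpen Ω' → CompactlyContained Ω' Ω →
    ∀ φ : Eucl n → ℝ, MemW1pZero p Ω' φ → (∀ x, 0 ≤ φ x) →
    ∀ G H : Eucl n → Eucl n, HasWeakGradient Ω' u G → HasWeakGradient Ω' φ H →
      (∫ x in Ω', ‖G x‖ ^ (p - 2) * inner ℝ (G x) (H x)) +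
        (∫ z : Eucl n × Eucl n,
          |u z.1 - u z.2| ^ (p - 2) * (u z.1 - u z.2) * (φ z.1 - φ z.2) * K z.1 z.2
            ∂((volume : Measure (Eucl n)).prod volume)) ≤ 0

/-- The Lebesgue points of `u` in `Ω`. -/
def lebesguePoints {n : ℕ} (Ω : Set (Eucl n)) (u : Eucl n → ℝ) : Set (Eucl n) :=
  {x | x ∈ Ω ∧ Tendsto (fun r : ℝ => ⨍ y in Metric.ball x r, |u x - u y|) (𝓝[>] 0) (𝓝 0)}

/-- The essential supremum of `u` over the ball `B_r(x)`. -/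
noncomputable def essSupBall {n : ℕ} (u : Eucl n → ℝ) (x : Eucl n) (r : ℝ) : ℝ :=
  essSup u (volume.restrict (Metric.ball x r))

/-- The upper semicontinuous regularization `u^*(x) = lim_{r → 0} ess sup_{B_r(x)} u`. -/
noncomputable def uscReg {n : ℕ} (u : Eucl n → ℝ) (x : Eucl n) : ℝ :=
  limUnder (𝓝[>] (0 : ℝ)) (essSupBall u x)

end MixedPLaplace

/-! The equation is needed only for `uscReg u x ≤ u x` at a Lebesgue point. Existence of the limit
and upper semicontinuity follow from monotonicity of the essential supremum in the ball, and `u x ≤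
uscReg u x` follows by averaging; these hold for every function in `L^∞`.

The upper bound is a De Giorgi iteration in which a paraboloid replaces the cutoff functions. Let
`|u| ≤ L` and `g = κ |x - x₀|² / r² + k` with `κ + k ≥ L`. Then `u ≤ g` outside `B_r(x₀)`, so `φ = T
(u - g)`, with `T` a smooth nondecreasing step rising from 0 to 1 on `[0, δ]`, is an admissible test
function. Put `A = {u > g}`. Coercivity of the local term controls `r^(1-p) ∫ |∇φ|` up to `C r^(-p)
|A| / δ`. In the nonlocal term, a pair with `u x ≥ u y` has the bad sign only if `φ y > φ x`; this
forces `y ∈ A` and `u x - u y < g x - g y`. The bad part is therefore governed by the increment of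
`g` at short range and by the global bound on `u` at long range, and it integrates to at most `C
r^(-ps) |A| / δ`.

Hence `∫ |∇φ| ≤ C |A| / (r δ)` (`exists_integral_norm_gradient_le`), and the `W^{1,1}` Sobolev
inequality turns this into superlinear decay of superlevel sets
(`exists_measureReal_superlevel_le`). Iterating over levels between `l + M` and `l + 2M` shows that
if `u - barrier` exceeds `l + M` on a set of measure at most `(ν r)^n`, then it is at most `l + 2M`
almost everywhere, with `ν` independent of `r` (`exists_ae_le_of_measureReal_le`).

At a Lebesgue point with value `l`, Chebyshev's inequality supplies this smallness for small `r`.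
The barrier is at most `M` on a smaller concentric ball, so `uscReg u x₀ ≤ l + 3M`, and `M` is
arbitrary. -/

namespace MixedPLaplace

open scoped ENNReal NNReal Convolution

/-! ### Mollification in `L^p` and its action on weak gradients -/

section Mollification

/-- Jensen's inequality for the probability density `a`, obtained from Hölder by writing `a b =
a^(1/q) · (a^(1/p) b)`. -/
theorem rpow_lintegral_mul_le {α : Type*} [MeasurableSpace α] {μ : Measure α} {p : ℝ} (hp : 1 < p)
    {a b : α → ℝ≥0∞} (ha : AEMeasurable a μ) (hb : AEMeasurable b μ) (h1 : ∫⁻ x, a x ∂μ = 1) :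
    (∫⁻ x, a x * b x ∂μ) ^ p ≤ ∫⁻ x, a x * b x ^ p ∂μ := by
  have hp0 : 0 < p := by linarith
  have hpq := Real.HolderConjugate.conjExponent hp
  set q := p.conjExponent with hq
  have hq0 : 0 < q := hpq.symm.pos
  have key := ENNReal.lintegral_mul_le_Lp_mul_Lq μ hpq.symm
    (f := fun x => a x ^ (1 / q)) (g := fun x => a x ^ (1 / p) * b x)
    (ha.pow_const _) ((ha.pow_const _).mul hb)
  have e1 : ∀ x, ((fun x => a x ^ (1 / q)) * fun x => a x ^ (1 / p) * b x) x = a x * b x := by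
    intro x
    simp only [Pi.mul_apply]
    rw [← mul_assoc, ← ENNReal.rpow_add_of_nonneg _ _ (by positivity) (by positivity)]
    have : 1 / q + 1 / p = 1 := by
      have := hpq.symm.inv_add_inv_eq_one
      simpa [one_div] using this
    rw [this, ENNReal.rpow_one]
  have e2 : ∀ x, (a x ^ (1 / q)) ^ q = a x := by
    intro x
    rw [← ENNReal.rpow_mul, one_div, inv_mul_cancel₀ hq0.ne', ENNReal.rpow_one]
  have e3 : ∀ x, (a x ^ (1 / p) * b x) ^ p = a x * b x ^ p := by
    intro x
    rw [ENNReal.mul_rpow_of_nonneg _ _ hp0.le, ← ENNReal.rpow_mul, one_div,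
      inv_mul_cancel₀ hp0.ne', ENNReal.rpow_one]
  simp only [e1, e2, e3, h1, ENNReal.one_rpow, one_mul] at key
  calc (∫⁻ x, a x * b x ∂μ) ^ p ≤ ((∫⁻ x, a x * b x ^ p ∂μ) ^ (1 / p)) ^ p := by gcongr
    _ = _ := by rw [← ENNReal.rpow_mul, one_div, inv_mul_cancel₀ hp0.ne', ENNReal.rpow_one]

variable {n : ℕ} {F : Type*} [NormedAddCommGroup F] [NormedSpace ℝ F]

/-- Convolution of `f` with the normalized bump function `φ`. -/
noncomputable def mollify (φ : ContDiffBump (0 : Eucl n)) (f : Eucl n → F) : Eucl n → F :=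
  φ.normed volume ⋆[ContinuousLinearMap.lsmul ℝ ℝ, volume] f

theorem mollify_apply (φ : ContDiffBump (0 : Eucl n)) (f : Eucl n → F) (x : Eucl n) :
    mollify φ f x = ∫ t, φ.normed volume t • f (x - t) := rfl

theorem lintegral_enorm_normed (φ : ContDiffBump (0 : Eucl n)) :
    ∫⁻ t, ‖φ.normed (volume : Measure (Eucl n)) t‖ₑ = 1 := by
  have h := ofReal_integral_norm_eq_lintegral_enorm
    (φ.integrable_normed (μ := (volume : Measure (Eucl n))))
  rw [← h]
  simp_rw [Real.norm_of_nonneg (φ.nonneg_normed _)]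
  rw [φ.integral_normed, ENNReal.ofReal_one]

/-- Young's inequality for a kernel of mass one: Jensen inside the convolution, then Tonelli and
translation invariance. -/
theorem eLpNorm_mollify_le (φ : ContDiffBump (0 : Eucl n)) {p : ℝ} (hp : 1 < p) {f : Eucl n → F}
    (hf : AEStronglyMeasurable f volume) :
    eLpNorm (mollify φ f) (ENNReal.ofReal p) volume ≤ eLpNorm f (ENNReal.ofReal p) volume := by
  have hp0 : 0 < p := by linarith
  have hP0 : ENNReal.ofReal p ≠ 0 := by simpa using hp0
  rw [eLpNorm_eq_lintegral_rpow_enorm_toReal hP0 ENNReal.ofReal_ne_top,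
    eLpNorm_eq_lintegral_rpow_enorm_toReal hP0 ENNReal.ofReal_ne_top,
    ENNReal.toReal_ofReal hp0.le]
  gcongr ?_ ^ _
  set ρ := φ.normed (volume : Measure (Eucl n)) with hρ
  have hρm : Measurable fun t => ‖ρ t‖ₑ := (φ.continuous_normed.measurable).enorm
  have hfm : AEMeasurable (fun z : Eucl n × Eucl n => ‖f (z.1 - z.2)‖ₑ ^ p)
      (volume.prod volume) :=
    ((hf.comp_quasiMeasurePreserving
      (quasiMeasurePreserving_sub_of_right_invariant volume volume)).enorm).pow_const p
  have hft : ∀ x, AEMeasurable (fun t => ‖f (x - t)‖ₑ) volume := fun x =>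
    (hf.comp_quasiMeasurePreserving
      (quasiMeasurePreserving_sub_left_of_right_invariant volume x)).enorm
  calc ∫⁻ x, ‖mollify φ f x‖ₑ ^ p
      ≤ ∫⁻ x, ∫⁻ t, ‖ρ t‖ₑ * ‖f (x - t)‖ₑ ^ p := by
        gcongr with x
        refine le_trans ?_ (rpow_lintegral_mul_le hp hρm.aemeasurable (hft x)
          (lintegral_enorm_normed φ))
        gcongr
        rw [mollify_apply]
        refine (enorm_integral_le_lintegral_enorm _).trans_eq ?_
        simp_rw [enorm_smul]
        rfl
    _ = ∫⁻ t, ∫⁻ x, ‖ρ t‖ₑ * ‖f (x - t)‖ₑ ^ p := by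
        rw [lintegral_lintegral_swap]
        exact ((hρm.comp measurable_snd).aemeasurable).mul hfm
    _ = ∫⁻ t, ‖ρ t‖ₑ * ∫⁻ x, ‖f x‖ₑ ^ p := by
        congr 1 with t
        rw [lintegral_const_mul' _ _ enorm_ne_top,
          lintegral_sub_right_eq_self (fun x => ‖f x‖ₑ ^ p) t]
    _ = ∫⁻ x, ‖f x‖ₑ ^ p := by
        rw [lintegral_mul_const _ hρm, lintegral_enorm_normed, one_mul]

theorem mollify_sub (φ : ContDiffBump (0 : Eucl n)) {f g : Eucl n → F}
    (hf : LocallyIntegrable f volume) (hg : LocallyIntegrable g volume) :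
    mollify φ (f - g) = mollify φ f - mollify φ g := by
  have h : ∀ {f : Eucl n → F}, LocallyIntegrable f volume → ∀ x,
      Integrable (fun t => φ.normed volume t • f (x - t)) := fun hf x =>
    φ.hasCompactSupport_normed.convolutionExists_left (ContinuousLinearMap.lsmul ℝ ℝ)
      φ.continuous_normed hf x
  ext x
  simp only [mollify_apply, Pi.sub_apply, smul_sub]
  exact integral_sub (h hf x) (h hg x)

/-- Uniform continuity makes the difference uniformly small, and once the bump radius is below 1 its
support stays in a fixed compact neighbourhood of the support of `g`. -/
theorem tendsto_eLpNorm_mollify_sub_of_continuous [CompleteSpace F]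
    {φ : ℕ → ContDiffBump (0 : Eucl n)} (hφ : Tendsto (fun k => (φ k).rOut) atTop (𝓝 0))
    {p : ℝ} (hp : 1 < p) {g : Eucl n → F} (hg : Continuous g) (hgc : HasCompactSupport g) :
    Tendsto (fun k => eLpNorm (mollify (φ k) g - g) (ENNReal.ofReal p) volume)
      atTop (𝓝 0) := by
  have hp0 : 0 < p := by linarith
  have huc := hgc.uniformContinuous_of_continuous hg
  set S := Metric.cthickening 1 (tsupport g) with hS
  have hSc : IsCompact S := hgc.isCompact.cthickening
  set m : ℝ≥0∞ := volume S ^ (ENNReal.ofReal p).toReal⁻¹ with hm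
  have hmt : m ≠ ⊤ := ENNReal.rpow_ne_top_of_nonneg (by positivity) hSc.measure_lt_top.ne
  have hmain : ∀ ε > 0, ∀ᶠ k in atTop,
      eLpNorm (mollify (φ k) g - g) (ENNReal.ofReal p) volume ≤ m * ENNReal.ofReal ε := by
    intro ε hε
    obtain ⟨δ, hδ, hδ'⟩ := Metric.uniformContinuous_iff.1 huc ε hε
    filter_upwards [hφ.eventually (gt_mem_nhds (lt_min hδ one_pos))] with k hk
    have hk1 := hk.trans_le (min_le_left _ _)
    have hk2 := hk.trans_le (min_le_right _ _)
    have hd : ∀ x, ‖(mollify (φ k) g - g) x‖ ≤ ε := by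
      intro x
      rw [Pi.sub_apply, ← dist_eq_norm]
      exact ContDiffBump.dist_normed_convolution_le hg.aestronglyMeasurable
        fun y hy => (hδ' ((Metric.mem_ball.1 hy).trans hk1)).le
    have hs : Function.support (mollify (φ k) g - g) ⊆ S := by
      intro x hx
      by_contra hxS
      apply hx
      have hz : ∀ y ∈ Metric.closedBall x 1, g y = 0 := by
        intro y hy
        by_contra hgy
        exact hxS (Metric.mem_cthickening_of_dist_le x y 1 _
          (subset_tsupport g hgy) (by rw [dist_comm]; exact Metric.mem_closedBall.1 hy))
      have hx0 : g x = 0 := hz x (Metric.mem_closedBall_self zero_le_one)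
      have : mollify (φ k) g x = g x := by
        apply ContDiffBump.normed_convolution_eq_right
        intro y hy
        rw [hx0, hz y (Metric.mem_closedBall.2 ((Metric.mem_ball.1 hy).trans hk2).le)]
      simp [this]
    rw [← eLpNorm_restrict_eq_of_support_subset hs]
    refine (eLpNorm_le_of_ae_bound (Eventually.of_forall hd)).trans_eq ?_
    rw [Measure.restrict_apply_univ]
  rw [ENNReal.tendsto_nhds_zero]
  intro η hη
  have ht : Tendsto (fun ε : ℝ => m * ENNReal.ofReal ε) (𝓝[>] 0) (𝓝 0) := by
    have : Tendsto (fun ε : ℝ => m * ENNReal.ofReal ε) (𝓝 0) (𝓝 (m * ENNReal.ofReal 0)) :=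
      ENNReal.Tendsto.const_mul (ENNReal.continuous_ofReal.tendsto 0) (Or.inr hmt)
    simp only [ENNReal.ofReal_zero, mul_zero] at this
    exact this.mono_left nhdsWithin_le_nhds
  obtain ⟨ε, hε1, hε2⟩ := (((ENNReal.tendsto_nhds_zero.1 ht) η hη).and
    self_mem_nhdsWithin).exists
  filter_upwards [hmain ε hε2] with k hk using hk.trans hε1

/-- Density of compactly supported continuous functions, with the contraction property of
mollification: a three-term `η / 3` argument. -/
theorem tendsto_eLpNorm_mollify_sub [CompleteSpace F]
    {φ : ℕ → ContDiffBump (0 : Eucl n)} (hφ : Tendsto (fun k => (φ k).rOut) atTop (𝓝 0))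
    {p : ℝ} (hp : 1 < p) {f : Eucl n → F} (hf : MemLp f (ENNReal.ofReal p) volume) :
    Tendsto (fun k => eLpNorm (mollify (φ k) f - f) (ENNReal.ofReal p) volume)
      atTop (𝓝 0) := by
  have hp1 : 1 ≤ ENNReal.ofReal p := by simpa using ENNReal.ofReal_le_ofReal hp.le
  rw [ENNReal.tendsto_nhds_zero]
  intro η hη
  by_cases hηt : η = ⊤
  · simp [hηt]
  have h3 : η / 3 ≠ 0 := by simp [hη.ne']
  obtain ⟨g, hgc, hfg, hg, hgL⟩ :=
    hf.exists_hasCompactSupport_eLpNorm_sub_le ENNReal.ofReal_ne_top h3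
  have hlf := hf.locallyIntegrable hp1
  have hlg := hgL.locallyIntegrable hp1
  have hmeas : ∀ k, ∀ {f : Eucl n → F}, LocallyIntegrable f volume →
      AEStronglyMeasurable (mollify (φ k) f) volume := fun k f hf =>
    ((φ k).hasCompactSupport_normed.continuous_convolution_left
      (ContinuousLinearMap.lsmul ℝ ℝ) (φ k).continuous_normed hf).aestronglyMeasurable
  filter_upwards [(ENNReal.tendsto_nhds_zero.1
    (tendsto_eLpNorm_mollify_sub_of_continuous hφ hp hg hgc)) (η / 3) (pos_iff_ne_zero.2 h3)]
    with k hk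
  have e : mollify (φ k) f - f = mollify (φ k) (f - g) + ((mollify (φ k) g - g) + (g - f)) := by
    rw [mollify_sub _ hlf hlg]; abel
  have hfg' : AEStronglyMeasurable (f - g) volume := hf.1.sub hgL.1
  rw [e]
  calc _ ≤ eLpNorm (mollify (φ k) (f - g)) (ENNReal.ofReal p) volume +
        (eLpNorm (mollify (φ k) g - g) (ENNReal.ofReal p) volume +
          eLpNorm (g - f) (ENNReal.ofReal p) volume) := by
        refine (eLpNorm_add_le (hmeas k (hlf.sub hlg))
          (((hmeas k hlg).sub hgL.1).add (hgL.1.sub hf.1)) hp1).trans ?_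
        gcongr
        exact eLpNorm_add_le ((hmeas k hlg).sub hgL.1) (hgL.1.sub hf.1) hp1
    _ ≤ η / 3 + (η / 3 + η / 3) := by
        gcongr
        · exact (eLpNorm_mollify_le _ hp hfg').trans hfg
        · rw [eLpNorm_sub_comm]; exact hfg
    _ = η := by rw [← add_assoc, ENNReal.add_thirds]

theorem norm_mollify_le (φ : ContDiffBump (0 : Eucl n)) {f : Eucl n → F} {L : ℝ}
    (hf : ∀ x, ‖f x‖ ≤ L) (x : Eucl n) : ‖mollify φ f x‖ ≤ L := by
  rw [mollify_apply]
  calc ‖∫ t, φ.normed volume t • f (x - t)‖ ≤ ∫ t, φ.normed volume t * L := by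
        refine norm_integral_le_of_norm_le (φ.integrable_normed.mul_const L)
          (Eventually.of_forall fun t => ?_)
        rw [norm_smul, Real.norm_of_nonneg (φ.nonneg_normed t)]
        exact mul_le_mul_of_nonneg_left (hf _) (φ.nonneg_normed t)
    _ = L := by rw [integral_mul_const, φ.integral_normed, one_mul]

theorem contDiff_mollify (φ : ContDiffBump (0 : Eucl n)) {f : Eucl n → F}
    (hf : LocallyIntegrable f volume) : ContDiff ℝ ∞ (mollify φ f) :=
  φ.hasCompactSupport_normed.contDiff_convolution_left (n := ⊤) (ContinuousLinearMap.lsmul ℝ ℝ)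
    φ.contDiff_normed hf

/-- The derivative of the mollification is the mollification of the weak gradient. -/
theorem fderiv_mollify {U : Set (Eucl n)} {u : Eucl n → ℝ} {G : Eucl n → Eucl n}
    (hU : MeasurableSet U) (hG : HasWeakGradient U u G)
    (hul : LocallyIntegrable (U.indicator u) volume)
    (hGl : LocallyIntegrable (U.indicator G) volume)
    (φ : ContDiffBump (0 : Eucl n)) {x : Eucl n} (hx : Metric.closedBall x φ.rOut ⊆ U)
    (v : Eucl n) :
    fderiv ℝ (mollify φ (U.indicator u)) x v = inner ℝ (mollify φ (U.indicator G) x) v := by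
  set ρ := φ.normed (volume : Measure (Eucl n)) with hρ
  have hρ1 : ContDiff ℝ ∞ ρ := φ.contDiff_normed (n := ⊤)
  have hd := (φ.hasCompactSupport_normed (μ := volume)).hasFDerivAt_convolution_left
    (ContinuousLinearMap.lsmul ℝ ℝ) (φ.contDiff_normed (n := 1)) hul x
  have hcs : HasCompactSupport (fderiv ℝ ρ) := φ.hasCompactSupport_normed.fderiv ℝ
  have hcd : Continuous (fderiv ℝ ρ) := hρ1.continuous_fderiv (by simp)
  have hint := hcs.convolutionExists_left
    (ContinuousLinearMap.precompL (Eucl n) (ContinuousLinearMap.lsmul ℝ ℝ (E := ℝ))) hcd hul x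
  have hint' : Integrable fun t => (φ.normed volume t) • U.indicator G (x - t) :=
    φ.hasCompactSupport_normed.convolutionExists_left (ContinuousLinearMap.lsmul ℝ ℝ)
      φ.continuous_normed hGl x
  -- The reflected bump `t ↦ ρ (x - t)` is the test function for the weak gradient; `hx` keeps its
  -- support inside `U`. The sign from differentiating in `t` cancels the one in the definition of
  -- the weak gradient.
  have hχ : IsTestFunction U (fun t => ρ (x - t)) := by
    have hc : HasCompactSupport (fun t => ρ (x - t)) :=
      (φ.hasCompactSupport_normed (μ := volume)).comp_homeomorph (Homeomorph.subLeft x)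
    refine ⟨hρ1.comp (contDiff_const.sub contDiff_id), hc, ?_⟩
    refine (closure_minimal ?_ Metric.isClosed_closedBall).trans hx
    intro t ht
    have : x - t ∈ Function.support ρ := ht
    rw [hρ, φ.support_normed_eq, mem_ball_zero_iff] at this
    rw [Metric.mem_closedBall, dist_comm, dist_eq_norm]
    exact this.le
  have key := hG.integral_eq _ hχ v
  have hfd : ∀ t, fderiv ℝ (fun t => ρ (x - t)) t v = - fderiv ℝ ρ (x - t) v := by
    intro t
    have h1 : HasFDerivAt ρ (fderiv ℝ ρ (x - t)) (x - t) :=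
      (hρ1.differentiable (by simp) _).hasFDerivAt
    have h2 : HasFDerivAt (fun t => x - t) (-ContinuousLinearMap.id ℝ (Eucl n)) t :=
      (hasFDerivAt_id t).const_sub x
    have h3 : HasFDerivAt (fun t => ρ (x - t)) _ t := h1.comp t h2
    rw [h3.fderiv]
    simp
  rw [show fderiv ℝ (mollify φ (U.indicator u)) x = _ from hd.fderiv]
  rw [convolution_def, ContinuousLinearMap.integral_apply hint, mollify_apply,
    ← real_inner_comm, ← integral_inner hint']
  simp_rw [hfd, mul_neg] at key
  rw [integral_neg, neg_inj, ← integral_indicator hU, ← integral_indicator hU] at key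
  rw [← integral_sub_left_eq_self _ volume x,
    ← integral_sub_left_eq_self (fun t => inner ℝ v _) volume x]
  simp only [sub_sub_cancel]
  refine Eq.trans (congrArg _ (funext fun t => ?_)) (key.trans (congrArg _ (funext fun t => ?_)))
  · by_cases ht : t ∈ U <;> simp [ht, ContinuousLinearMap.precompL_apply, mul_comm, hρ]
  · by_cases ht : t ∈ U <;> simp [ht, inner_smul_right, hρ, real_inner_comm, mul_comm]

end Mollification

/-! ### Convergence in `L^p` -/

section LpConvergence

variable {α : Type*} [MeasurableSpace α] {μ : Measure α} {F : Type*} [NormedAddCommGroup F]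

theorem tendsto_eLpNorm_zero_of_dominated {p : ℝ} (hp : 1 < p) {f : ℕ → α → F} {g : α → ℝ}
    (hf : ∀ k, AEStronglyMeasurable (f k) μ) (hg : MemLp g (ENNReal.ofReal p) μ)
    (hfg : ∀ k, ∀ᵐ x ∂μ, ‖f k x‖ ≤ g x)
    (hlim : ∀ᵐ x ∂μ, Tendsto (fun k => f k x) atTop (𝓝 0)) :
    Tendsto (fun k => eLpNorm (f k) (ENNReal.ofReal p) μ) atTop (𝓝 0) := by
  have hp0 : 0 < p := by linarith
  have hP0 : ENNReal.ofReal p ≠ 0 := by simpa using hp0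
  simp_rw [eLpNorm_eq_lintegral_rpow_enorm_toReal hP0 ENNReal.ofReal_ne_top,
    ENNReal.toReal_ofReal hp0.le]
  have h0 : Tendsto (fun k => ∫⁻ x, ‖f k x‖ₑ ^ p ∂μ) atTop (𝓝 (∫⁻ _, 0 ∂μ)) := by
    refine tendsto_lintegral_of_dominated_convergence' (fun x => ‖g x‖ₑ ^ p)
      (fun k => (hf k).enorm.pow_const p) (fun k => ?_) ?_ ?_
    · filter_upwards [hfg k] with x hx
      gcongr
      exact enorm_le_iff_norm_le.2 (hx.trans (le_abs_self _))
    · have := lintegral_rpow_enorm_lt_top_of_eLpNorm_lt_top hP0 ENNReal.ofReal_ne_top hg.2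
      rw [ENNReal.toReal_ofReal hp0.le] at this
      exact this.ne
    · filter_upwards [hlim] with x hx
      have h := (ENNReal.continuous_rpow_const (y := p)).continuousAt.tendsto.comp hx.enorm
      simpa [ENNReal.zero_rpow_of_pos hp0, Function.comp_def] using h
  have h := (ENNReal.continuous_rpow_const (y := 1 / p)).continuousAt.tendsto.comp h0
  simpa [ENNReal.zero_rpow_of_pos (show 0 < p⁻¹ by positivity), Function.comp_def] using h

theorem tendsto_eLpNorm_one_of_tendsto_eLpNorm [IsFiniteMeasure μ] {q : ℝ≥0∞} (hq : 1 ≤ q)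
    {f : ℕ → α → F} (hf : ∀ k, AEStronglyMeasurable (f k) μ)
    (h : Tendsto (fun k => eLpNorm (f k) q μ) atTop (𝓝 0)) :
    Tendsto (fun k => eLpNorm (f k) 1 μ) atTop (𝓝 0) := by
  refine tendsto_of_tendsto_of_tendsto_of_le_of_le tendsto_const_nhds ?_ (fun _ => zero_le)
    (fun k => eLpNorm_le_eLpNorm_mul_rpow_measure_univ hq (hf k))
  have hc : μ Set.univ ^ (1 / (1 : ℝ≥0∞).toReal - 1 / q.toReal) ≠ ⊤ := by
    refine ENNReal.rpow_ne_top_of_nonneg ?_ (measure_ne_top μ _)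
    by_cases hqt : q = ⊤
    · simp [hqt]
    · have : 1 ≤ q.toReal := by
        simpa using (ENNReal.toReal_le_toReal (by simp) hqt).2 hq
      have := inv_le_one_of_one_le₀ this
      simpa using this
  simpa using ENNReal.Tendsto.mul_const h (Or.inr hc)

theorem tendsto_integral_mul_of_tendsto_eLpNorm [IsFiniteMeasure μ] {q : ℝ≥0∞} (hq : 1 ≤ q)
    {f : ℕ → α → ℝ} {f₀ g : α → ℝ} (hf : ∀ k, MemLp (f k) q μ) (hf₀ : MemLp f₀ q μ)
    (hg : AEStronglyMeasurable g μ) {C : ℝ} (hgC : ∀ x, |g x| ≤ C)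
    (h : Tendsto (fun k => eLpNorm (fun x => f k x - f₀ x) q μ) atTop (𝓝 0)) :
    Tendsto (fun k => ∫ x, f k x * g x ∂μ) atTop (𝓝 (∫ x, f₀ x * g x ∂μ)) := by
  have hi : ∀ {f : α → ℝ}, MemLp f q μ → Integrable (fun x => f x * g x) μ := fun hf =>
    (hf.integrable hq).mul_bdd hg (Eventually.of_forall hgC)
  refine tendsto_integral_of_L1' _ (hi hf₀).aestronglyMeasurable (Eventually.of_forall fun k => hi (hf k)) ?_
  have h1 := tendsto_eLpNorm_one_of_tendsto_eLpNorm hq (fun k => (hf k).1.sub hf₀.1) h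
  refine tendsto_of_tendsto_of_tendsto_of_le_of_le tendsto_const_nhds ?_ (fun _ => zero_le)
    (fun k => eLpNorm_le_mul_eLpNorm_of_ae_le_mul (g := f k - f₀) (c := C)
      (Eventually.of_forall fun x => ?_) 1)
  · simpa using ENNReal.Tendsto.const_mul h1 (Or.inr ENNReal.ofReal_ne_top)
  · simp only [Pi.sub_apply, Real.norm_eq_abs]
    rw [← sub_mul, abs_mul, mul_comm]
    exact mul_le_mul_of_nonneg_right (hgC x) (abs_nonneg _)

end LpConvergence

/-! ### Gradients and limits of test functions -/

section WeakGradient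

variable {n : ℕ}

theorem fderiv_apply_eq_inner_gradient (f : Eucl n → ℝ) (x v : Eucl n) :
    fderiv ℝ f x v = inner ℝ (gradient f x) v := by
  rw [← toDual_gradient (𝕜 := ℝ), InnerProductSpace.toDual_apply_apply]

theorem gradient_eq_of_fderiv_apply {f : Eucl n → ℝ} {x g : Eucl n}
    (h : ∀ v, fderiv ℝ f x v = inner ℝ g v) : gradient f x = g :=
  ext_inner_right ℝ fun v => by rw [← fderiv_apply_eq_inner_gradient, h]

theorem norm_gradient (f : Eucl n → ℝ) (x : Eucl n) : ‖gradient f x‖ = ‖fderiv ℝ f x‖ := by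
  rw [← toDual_gradient (𝕜 := ℝ), LinearIsometryEquiv.norm_map]

theorem continuous_gradient {f : Eucl n → ℝ} (hf : ContDiff ℝ ∞ f) : Continuous (gradient f) :=
  (InnerProductSpace.toDual ℝ (Eucl n)).symm.continuous.comp (hf.continuous_fderiv (by simp))

theorem IsTestFunction.integral_mul_fderiv {U : Set (Eucl n)} {f χ : Eucl n → ℝ}
    (hf : IsTestFunction U f) (hχ : IsTestFunction U χ) (v : Eucl n) :
    ∫ x in U, f x * fderiv ℝ χ x v = - ∫ x in U, inner ℝ (gradient f x) v * χ x := by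
  have c1 : Continuous fun x => fderiv ℝ χ x v :=
    (hχ.1.continuous_fderiv (by simp)).clm_apply continuous_const
  have c2 : Continuous fun x => fderiv ℝ f x v :=
    (hf.1.continuous_fderiv (by simp)).clm_apply continuous_const
  rw [setIntegral_eq_integral_of_forall_compl_eq_zero,
    setIntegral_eq_integral_of_forall_compl_eq_zero]
  · simp_rw [← fderiv_apply_eq_inner_gradient]
    refine integral_mul_fderiv_eq_neg_fderiv_mul_of_integrable ?_ ?_ ?_ ?_ ?_
    · exact (c2.mul hχ.1.continuous).integrable_of_hasCompactSupport hχ.2.1.mul_left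
    · exact (hf.1.continuous.mul c1).integrable_of_hasCompactSupport hf.2.1.mul_right
    · exact (hf.1.continuous.mul hχ.1.continuous).integrable_of_hasCompactSupport hf.2.1.mul_right
    · exact fun x _ => hf.1.differentiable (by simp) x
    · exact fun x _ => hχ.1.differentiable (by simp) x
  · intro x hx
    rw [image_eq_zero_of_notMem_tsupport (fun h => hx (hχ.2.2 h)), mul_zero]
  · intro x hx
    rw [image_eq_zero_of_notMem_tsupport (fun h => hx (hf.2.2 h)), zero_mul]

/-- `φ` and `H` are the limits in `L^p(U)` of test functions and of their gradients. -/
structure IsTestLimit (p : ℝ) (U : Set (Eucl n)) (φ : Eucl n → ℝ) (H : Eucl n → Eucl n)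
    (ψ : ℕ → Eucl n → ℝ) : Prop where
  test : ∀ k, IsTestFunction U (ψ k)
  tendsto : Tendsto (fun k => eLpNorm (fun x => ψ k x - φ x) (ENNReal.ofReal p)
    (volume.restrict U)) atTop (𝓝 0)
  tendsto_gradient : Tendsto (fun k => eLpNorm (fun x => gradient (ψ k) x - H x)
    (ENNReal.ofReal p) (volume.restrict U)) atTop (𝓝 0)

/-- Both sides of the integration by parts formula are continuous under `L^p` convergence on a set
of finite measure, because `χ` and its derivatives are bounded. -/
theorem IsTestLimit.hasWeakGradient {p : ℝ} (hp : 1 < p) {U : Set (Eucl n)} (hUf : volume U < ⊤)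
    {φ : Eucl n → ℝ} {H : Eucl n → Eucl n} {ψ : ℕ → Eucl n → ℝ} (h : IsTestLimit p U φ H ψ)
    (hφ : MemLp φ (ENNReal.ofReal p) (volume.restrict U))
    (hH : MemLp H (ENNReal.ofReal p) (volume.restrict U)) : HasWeakGradient U φ H := by
  have hp1 : 1 ≤ ENNReal.ofReal p := by simpa using ENNReal.ofReal_le_ofReal hp.le
  have : IsFiniteMeasure (volume.restrict U) := ⟨by simpa using hUf⟩
  refine ⟨?_, ?_, fun χ hχ v => ?_⟩
  · exact IntegrableOn.locallyIntegrableOn (hφ.integrable hp1)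
  · exact IntegrableOn.locallyIntegrableOn (hH.integrable hp1)
  have c1 : Continuous fun x => fderiv ℝ χ x v :=
    (hχ.1.continuous_fderiv (by simp)).clm_apply continuous_const
  obtain ⟨C₀, hC₀⟩ := hχ.2.1.exists_bound_of_continuous hχ.1.continuous
  obtain ⟨C₁, hC₁⟩ := (hχ.2.1.fderiv_apply (𝕜 := ℝ) v).exists_bound_of_continuous c1
  have hψL : ∀ k, MemLp (ψ k) (ENNReal.ofReal p) (volume.restrict U) := fun k =>
    ((h.test k).1.continuous.memLp_of_hasCompactSupport (h.test k).2.1).restrict U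
  have hgc : ∀ k, HasCompactSupport (gradient (ψ k)) := fun k =>
    ((h.test k).2.1.fderiv ℝ).comp_left (map_zero _)
  have hgL : ∀ k, MemLp (gradient (ψ k)) (ENNReal.ofReal p) (volume.restrict U) := fun k =>
    ((continuous_gradient (h.test k).1).memLp_of_hasCompactSupport (hgc k)).restrict U
  have t1 := tendsto_integral_mul_of_tendsto_eLpNorm hp1 hψL hφ c1.aestronglyMeasurable hC₁
    h.tendsto
  have hiL : ∀ {H : Eucl n → Eucl n}, MemLp H (ENNReal.ofReal p) (volume.restrict U) →
      MemLp (fun x => inner ℝ (H x) v) (ENNReal.ofReal p) (volume.restrict U) := fun hH =>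
    hH.inner_const v
  have t2 := tendsto_integral_mul_of_tendsto_eLpNorm hp1 (fun k => hiL (hgL k)) (hiL hH)
    hχ.1.continuous.aestronglyMeasurable hC₀ (by
      refine tendsto_of_tendsto_of_tendsto_of_le_of_le tendsto_const_nhds ?_ (fun _ => zero_le)
        (fun k => eLpNorm_le_mul_eLpNorm_of_ae_le_mul (g := fun x => gradient (ψ k) x - H x)
          (c := ‖v‖) (Eventually.of_forall fun x => ?_) _)
      · simpa using ENNReal.Tendsto.const_mul (a := ENNReal.ofReal ‖v‖) h.tendsto_gradient
          (Or.inr ENNReal.ofReal_ne_top)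
      · rw [← inner_sub_left, mul_comm]
        exact norm_inner_le_norm _ _)
  refine tendsto_nhds_unique t1 (t2.neg.congr fun k => ?_)
  exact ((h.test k).integral_mul_fderiv hχ v).symm

theorem IsTestLimit.memW1pZero {p : ℝ} (hp : 1 < p) {U : Set (Eucl n)} (hUf : volume U < ⊤)
    {φ : Eucl n → ℝ} {H : Eucl n → Eucl n} {ψ : ℕ → Eucl n → ℝ} (h : IsTestLimit p U φ H ψ)
    (h0 : ∀ x, x ∉ U → φ x = 0)
    (hφ : MemLp φ (ENNReal.ofReal p) (volume.restrict U))
    (hH : MemLp H (ENNReal.ofReal p) (volume.restrict U)) : MemW1pZero p U φ :=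
  ⟨h0, hφ, H, h.hasWeakGradient hp hUf hφ hH, hH, ψ, h.test, h.tendsto, h.tendsto_gradient⟩

end WeakGradient

/-! ### Admissibility of `T (u - g)` as a test function -/

section Composition

variable {n : ℕ}

/-- Bump functions around the origin whose radii tend to zero and are at most `ε`. -/
noncomputable def bumpSeq (n : ℕ) {ε : ℝ} (hε : 0 < ε) (k : ℕ) : ContDiffBump (0 : Eucl n) where
  rIn := ε / (2 * (k + 1))
  rOut := ε / (k + 1)
  rIn_pos := by positivity
  rIn_lt_rOut := by
    apply div_lt_div_of_pos_left hε (by positivity)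
    have : (0 : ℝ) ≤ k := Nat.cast_nonneg k
    linarith

theorem bumpSeq_rOut_le {ε : ℝ} (hε : 0 < ε) (k : ℕ) : (bumpSeq n hε k).rOut ≤ ε :=
  div_le_self hε.le (by simp)

theorem tendsto_bumpSeq_rOut {ε : ℝ} (hε : 0 < ε) :
    Tendsto (fun k => (bumpSeq n hε k).rOut) atTop (𝓝 0) := by
  have := tendsto_one_div_add_atTop_nhds_zero_nat (𝕜 := ℝ)
  have h := this.const_mul ε
  simpa [bumpSeq, div_eq_mul_inv] using h

theorem bumpSeq_rOut_le_mul_rIn {ε : ℝ} (hε : 0 < ε) (k : ℕ) :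
    (bumpSeq n hε k).rOut ≤ 2 * (bumpSeq n hε k).rIn := by
  simp only [bumpSeq]
  apply le_of_eq
  field_simp

theorem gradient_comp_sub {T : ℝ → ℝ} (hT : ContDiff ℝ ∞ T) {f g : Eucl n → ℝ}
    (hf : ContDiff ℝ ∞ f) (hg : ContDiff ℝ ∞ g) (x : Eucl n) :
    gradient (fun y => T (f y - g y)) x =
      deriv T (f x - g x) • (gradient f x - gradient g x) := by
  apply gradient_eq_of_fderiv_apply
  intro v
  have h1 : HasDerivAt T (deriv T (f x - g x)) (f x - g x) :=
    (hT.differentiable (by simp) _).hasDerivAt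
  have h2 : HasFDerivAt (fun y => f y - g y) (fderiv ℝ f x - fderiv ℝ g x) x :=
    (hf.differentiable (by simp) x).hasFDerivAt.sub (hg.differentiable (by simp) x).hasFDerivAt
  have h3 : HasFDerivAt (fun y => T (f y - g y)) _ x := h1.comp_hasFDerivAt x h2
  rw [h3.fderiv]
  rw [inner_smul_left, inner_sub_left, ← fderiv_apply_eq_inner_gradient,
    ← fderiv_apply_eq_inner_gradient]
  rfl

/-- A smooth function of a bounded weakly differentiable function that vanishes near the boundary
of a ball is a limit of test functions. -/
theorem exists_isTestLimit_comp_sub {p : ℝ} (hp : 1 < p) {x₀ : Eucl n} {r R : ℝ} (hrR : r < R)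
    {L : ℝ} {u : Eucl n → ℝ} (hum : Measurable u) (huL : ∀ x, |u x| ≤ L)
    {G : Eucl n → Eucl n} (hG : HasWeakGradient (Metric.ball x₀ R) u G)
    (hGp : MemLp G (ENNReal.ofReal p) (volume.restrict (Metric.ball x₀ R)))
    {g : Eucl n → ℝ} (hg : ContDiff ℝ ∞ g) (hgL : ∀ x, x ∉ Metric.ball x₀ r → L ≤ g x)
    {T : ℝ → ℝ} (hT : ContDiff ℝ ∞ T) (hT0 : ∀ t ≤ 0, T t = 0) (hT0' : ∀ t ≤ 0, deriv T t = 0)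
    {C : ℝ} (hTC : ∀ t, |deriv T t| ≤ C) :
    MemLp (fun x => deriv T (u x - g x) • (G x - gradient g x)) (ENNReal.ofReal p)
      (volume.restrict (Metric.ball x₀ R)) ∧
    ∃ ψ, IsTestLimit p (Metric.ball x₀ R) (fun x => T (u x - g x))
      (fun x => deriv T (u x - g x) • (G x - gradient g x)) ψ := by
  set U := Metric.ball x₀ R with hU
  have hp1 : 1 ≤ ENNReal.ofReal p := by simpa using ENNReal.ofReal_le_ofReal hp.le
  have hUm : MeasurableSet U := measurableSet_ball
  have hUfin : volume U < ⊤ := measure_ball_lt_top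
  have hfinU : IsFiniteMeasure (volume.restrict U) := ⟨by simpa using hUfin⟩
  have hdT : Continuous (deriv T) := hT.continuous_deriv (by simp)
  have hvm : Measurable fun x => u x - g x := hum.sub hg.continuous.measurable
  -- the gradient of `g` is bounded on `U`
  have hPL : MemLp (gradient g) (ENNReal.ofReal p) (volume.restrict U) := by
    obtain ⟨B, hB⟩ := (isCompact_closedBall x₀ R).exists_bound_of_continuousOn
      (continuous_gradient hg).continuousOn
    refine MemLp.of_bound (continuous_gradient hg).aestronglyMeasurable B ?_
    filter_upwards [ae_restrict_mem hUm] with x hx using hB x (Metric.ball_subset_closedBall hx)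
  have hGPL := hGp.sub hPL
  have hHL : MemLp (fun x => deriv T (u x - g x) • (G x - gradient g x)) (ENNReal.ofReal p)
      (volume.restrict U) := by
    refine hGPL.of_le_mul (c := C)
      (((hdT.measurable.comp hvm).aestronglyMeasurable).smul hGPL.1)
      (Eventually.of_forall fun x => ?_)
    rw [norm_smul]
    exact mul_le_mul_of_nonneg_right (hTC _) (norm_nonneg _)
  refine ⟨hHL, ?_⟩
  -- mollify the truncations
  have huU : MemLp (U.indicator u) (ENNReal.ofReal p) volume :=
    (memLp_indicator_iff_restrict hUm).2
      (MemLp.of_bound hum.aestronglyMeasurable L (Eventually.of_forall huL))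
  have hGU : MemLp (U.indicator G) (ENNReal.ofReal p) volume :=
    (memLp_indicator_iff_restrict hUm).2 hGp
  have hul := huU.locallyIntegrable hp1
  have hGl := hGU.locallyIntegrable hp1
  -- Bump radii of at most `R - r` ensure that mollifying at a point of `B_r` only sees values in
  -- `B_R`.
  have hε : 0 < R - r := sub_pos.2 hrR
  set b := bumpSeq n hε with hb
  set w : ℕ → Eucl n → ℝ := fun k => mollify (b k) (U.indicator u) with hw
  have hwc : ∀ k, ContDiff ℝ ∞ (w k) := fun k => contDiff_mollify (b k) hul
  -- Mollification preserves the bound `L`, so the approximants also lie below `g` outside `B_r`;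
  -- this gives `T (w k - g)` its compact support.
  have hwL : ∀ k x, w k x ≤ L := fun k x => by
    refine (le_abs_self _).trans (norm_mollify_le (b k) (f := U.indicator u) (fun y => ?_) x)
    by_cases hy : y ∈ U
    · simpa [hy] using huL y
    · simpa [hy] using (abs_nonneg _).trans (huL y)
  have hw0 : ∀ k x, x ∉ Metric.ball x₀ r → w k x - g x ≤ 0 := fun k x hx =>
    sub_nonpos.2 ((hwL k x).trans (hgL x hx))
  have hu0 : ∀ x, x ∉ Metric.ball x₀ r → u x - g x ≤ 0 := fun x hx =>
    sub_nonpos.2 (((le_abs_self _).trans (huL x)).trans (hgL x hx))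
  have hgw : ∀ k x, x ∈ Metric.ball x₀ r →
      gradient (w k) x = mollify (b k) (U.indicator G) x := by
    intro k x hx
    refine gradient_eq_of_fderiv_apply fun v => fderiv_mollify hUm hG hul hGl (b k) ?_ v
    refine (Metric.closedBall_subset_closedBall (bumpSeq_rOut_le hε k)).trans ?_
    refine Metric.closedBall_subset_ball' ?_
    rw [Metric.mem_ball] at hx
    linarith
  have hψc : ∀ k, ContDiff ℝ ∞ fun x => T (w k x - g x) := fun k => hT.comp ((hwc k).sub hg)
  have hTl : ∀ s t, |T s - T t| ≤ C * |s - t| := fun s t =>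
    Convex.norm_image_sub_le_of_norm_deriv_le (s := Set.univ)
      (fun x _ => hT.differentiable (by simp) x) (fun x _ => hTC x) convex_univ trivial trivial
  have hC0 : 0 ≤ C := (abs_nonneg _).trans (hTC 0)
  refine ⟨fun k x => T (w k x - g x), ⟨fun k => ⟨hψc k, ?_⟩, ?_, ?_⟩⟩
  · have hs : tsupport (fun x => T (w k x - g x)) ⊆ Metric.closedBall x₀ r := by
      refine closure_minimal (fun x hx => ?_) Metric.isClosed_closedBall
      by_contra hxr
      exact hx (hT0 _ (hw0 k x fun h => hxr (Metric.ball_subset_closedBall h)))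
    exact ⟨HasCompactSupport.of_support_subset_isCompact (isCompact_closedBall x₀ r)
      ((subset_tsupport _).trans hs), hs.trans (Metric.closedBall_subset_ball hrR)⟩
  · have h1 := tendsto_eLpNorm_mollify_sub (tendsto_bumpSeq_rOut (n := n) hε) hp huU
    refine tendsto_of_tendsto_of_tendsto_of_le_of_le tendsto_const_nhds
      (h := fun k => ENNReal.ofReal C *
        eLpNorm (mollify (b k) (U.indicator u) - U.indicator u) (ENNReal.ofReal p) volume)
      ?_ (fun _ => zero_le) (fun k => ?_)
    · simpa using ENNReal.Tendsto.const_mul h1 (Or.inr ENNReal.ofReal_ne_top)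
    · refine (eLpNorm_le_mul_eLpNorm_of_ae_le_mul
        (g := mollify (b k) (U.indicator u) - U.indicator u) (c := C) ?_ _).trans ?_
      · filter_upwards [ae_restrict_mem hUm] with x hx
        refine (hTl _ _).trans_eq ?_
        simp [hx, hw]
      · exact mul_le_mul' le_rfl (eLpNorm_mono_measure _ Measure.restrict_le_self)
  · have h1 := tendsto_eLpNorm_mollify_sub (tendsto_bumpSeq_rOut (n := n) hε) hp hGU
    have hae := ContDiffBump.ae_convolution_tendsto_right_of_locallyIntegrable (μ := volume)
      (φ := b) (K := 2) (tendsto_bumpSeq_rOut (n := n) hε)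
      (Eventually.of_forall (bumpSeq_rOut_le_mul_rIn hε)) hul
    -- The gradient error splits as `T'(w k - g)` times the error of the mollified gradient, plus `D
    -- k`. The first part tends to zero because `T'` is bounded, the second by dominated
    -- convergence, since `w k → u` almost everywhere in `U`.
    set D : ℕ → Eucl n → Eucl n := fun k x =>
      (deriv T (w k x - g x) - deriv T (u x - g x)) • (G x - gradient g x) with hD
    have hDm : ∀ k, AEStronglyMeasurable (D k) (volume.restrict U) := fun k =>
      (((hdT.comp ((hwc k).sub hg).continuous).measurable.sub
        (hdT.measurable.comp hvm)).aestronglyMeasurable).smul hGPL.1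
    have h2 : Tendsto (fun k => eLpNorm (D k) (ENNReal.ofReal p) (volume.restrict U))
        atTop (𝓝 0) := by
      refine tendsto_eLpNorm_zero_of_dominated hp hDm (g := fun x => 2 * C * ‖(G - gradient g) x‖)
        (hGPL.norm.const_mul _) (fun k => Eventually.of_forall fun x => ?_) ?_
      · rw [hD, norm_smul]
        refine mul_le_mul_of_nonneg_right ?_ (norm_nonneg _)
        refine (norm_sub_le _ _).trans ?_
        have := hTC (w k x - g x)
        have := hTC (u x - g x)
        simp only [Real.norm_eq_abs]
        linarith
      · filter_upwards [ae_restrict_of_ae hae, ae_restrict_mem hUm] with x hx hxU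
        rw [Set.indicator_of_mem hxU] at hx
        have h3 : Tendsto (fun k => deriv T (w k x - g x)) atTop (𝓝 (deriv T (u x - g x))) :=
          (hdT.tendsto _).comp (hx.sub_const _)
        have h4 := (h3.sub_const (deriv T (u x - g x))).smul_const (G x - gradient g x)
        simpa using h4
    refine tendsto_of_tendsto_of_tendsto_of_le_of_le tendsto_const_nhds
      (h := fun k => ENNReal.ofReal C *
        eLpNorm (mollify (b k) (U.indicator G) - U.indicator G) (ENNReal.ofReal p) volume +
        eLpNorm (D k) (ENNReal.ofReal p) (volume.restrict U))
      ?_ (fun _ => zero_le) (fun k => ?_)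
    · simpa using (ENNReal.Tendsto.const_mul h1 (Or.inr ENNReal.ofReal_ne_top)).add h2
    · have hmm : AEStronglyMeasurable (mollify (b k) (U.indicator G) - U.indicator G) volume :=
        ((contDiff_mollify (b k) hGl).continuous.aestronglyMeasurable).sub hGU.1
      set E : Eucl n → Eucl n := fun x =>
        deriv T (w k x - g x) • (mollify (b k) (U.indicator G) - U.indicator G) x with hE
      have hEm : AEStronglyMeasurable E (volume.restrict U) :=
        ((hdT.comp ((hwc k).sub hg).continuous).aestronglyMeasurable).smul hmm.restrict
      calc _ = eLpNorm (E + D k) (ENNReal.ofReal p) (volume.restrict U) := by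
            refine eLpNorm_congr_ae ?_
            filter_upwards [ae_restrict_mem hUm] with x hx
            rw [gradient_comp_sub hT (hwc k) hg]
            simp only [hE, hD, Pi.add_apply, Pi.sub_apply, Set.indicator_of_mem hx]
            -- Outside `B_r` the gradient of `w k` is not identified with the mollified `G`, but
            -- there both factors `T'` vanish.
            by_cases hxr : x ∈ Metric.ball x₀ r
            · rw [hgw k x hxr]
              module
            · rw [hT0' _ (hw0 k x hxr), hT0' _ (hu0 x hxr)]
              simp
        _ ≤ eLpNorm E (ENNReal.ofReal p) (volume.restrict U) +
            eLpNorm (D k) (ENNReal.ofReal p) (volume.restrict U) :=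
            eLpNorm_add_le hEm (hDm k) hp1
        _ ≤ _ := by
            refine add_le_add ?_ le_rfl
            refine (eLpNorm_le_mul_eLpNorm_of_ae_le_mul
              (g := mollify (b k) (U.indicator G) - U.indicator G) (c := C) ?_ _).trans ?_
            · filter_upwards with x
              rw [hE, norm_smul]
              exact mul_le_mul_of_nonneg_right (hTC _) (norm_nonneg _)
            · exact mul_le_mul' le_rfl (eLpNorm_mono_measure _ Measure.restrict_le_self)

end Composition

/-! ### The `W^{1,1}` Sobolev inequality -/

section Sobolev

/-- The fundamental theorem of calculus on a half-line, transported along the isometry `ℝ ≃ Eucl 1`.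
It supplies the endpoint `χ = ∞` of the Sobolev scale. -/
theorem enorm_le_lintegral_enorm_fderiv_of_dim_one {f : Eucl 1 → ℝ} (hf : ContDiff ℝ 1 f)
    (hfc : HasCompactSupport f) (x : Eucl 1) : ‖f x‖ₑ ≤ ∫⁻ y, ‖fderiv ℝ f y‖ₑ := by
  let e : ℝ ≃ₗᵢ[ℝ] Eucl 1 := (OrthonormalBasis.singleton (Fin 1) ℝ).repr
  have hc : ContDiff ℝ 1 (f ∘ e) := hf.comp e.contDiff
  have hcs : HasCompactSupport (f ∘ e) := hfc.comp_homeomorph e.toHomeomorph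
  have h := hcs.enorm_le_lintegral_Ici_deriv hc (e.symm x)
  simp only [Function.comp_apply, LinearIsometryEquiv.apply_symm_apply] at h
  refine h.trans ((setLIntegral_le_lintegral _ _).trans ?_)
  rw [← e.measurePreserving.lintegral_comp
    ((hf.continuous_fderiv (by simp)).measurable.enorm)]
  refine lintegral_mono fun t => ?_
  have hd : HasDerivAt (f ∘ e) (fderiv ℝ f (e t) (e 1)) t := by
    have h1 : HasFDerivAt f (fderiv ℝ f (e t)) (e t) :=
      (hf.differentiable (by simp) _).hasFDerivAt
    have h2 : HasDerivAt e (e 1) t := by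
      have := e.toContinuousLinearEquiv.hasFDerivAt (x := t)
      exact this.hasDerivAt
    exact h1.comp_hasDerivAt t h2
  simp only [hd.deriv]
  refine enorm_le_iff_norm_le.2 ?_
  refine (ContinuousLinearMap.le_opNorm _ _).trans_eq ?_
  rw [e.norm_map, norm_one, mul_one]

/-- The Sobolev inequality for `W^{1,1}`, in a form that covers dimension one. -/
theorem exists_eLpNorm_le_eLpNorm_fderiv {n : ℕ} (hn : 1 ≤ n) :
    ∃ (χ : ℝ≥0∞) (C : ℝ≥0), 1 ≤ χ ∧ 1 - 1 / χ.toReal = 1 / (n : ℝ) ∧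
      ∀ f : Eucl n → ℝ, ContDiff ℝ 1 f → HasCompactSupport f →
        eLpNorm f χ volume ≤ C * eLpNorm (fderiv ℝ f) 1 volume := by
  rcases hn.eq_or_lt with rfl | hn
  · refine ⟨⊤, 1, le_top, by simp, fun f hf hfc => ?_⟩
    rw [eLpNorm_exponent_top, eLpNorm_one_eq_lintegral_enorm, ENNReal.coe_one, one_mul]
    exact essSup_le_of_ae_le _
      (Eventually.of_forall (enorm_le_lintegral_enorm_fderiv_of_dim_one hf hfc))
  · have hn1 : (1 : ℝ≥0) < n := by exact_mod_cast hn
    have hc := NNReal.HolderConjugate.conjExponent hn1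
    refine ⟨(n : ℝ≥0).conjExponent, eLpNormLESNormFDerivOneConst (volume : Measure (Eucl n))
      (n : ℝ≥0).conjExponent, ?_, ?_, fun f hf hfc => ?_⟩
    · exact_mod_cast hc.symm.lt.le
    · have h := hc.coe.inv_add_inv_eq_one
      rw [ENNReal.coe_toReal, one_div, one_div]
      rw [NNReal.coe_natCast] at h
      linarith
    · refine eLpNorm_le_eLpNorm_fderiv_one volume hf hfc ?_
      rw [finrank_euclideanSpace, Fintype.card_fin]
      exact hc

/-- Limits of test functions satisfy
`∫ |φ| ≤ C |{φ ≠ 0}|^{1/n} ∫ |∇φ|`. -/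
theorem exists_lintegral_le_measure_rpow_mul_lintegral_gradient {n : ℕ} (hn : 1 ≤ n) :
    ∃ C : ℝ≥0, ∀ (p : ℝ) (U S : Set (Eucl n)) (φ : Eucl n → ℝ) (H : Eucl n → Eucl n)
      (ψ : ℕ → Eucl n → ℝ), 1 < p → volume U < ⊤ → IsTestLimit p U φ H ψ →
      AEStronglyMeasurable φ (volume.restrict U) → AEStronglyMeasurable H (volume.restrict U) →
      (∀ x, x ∉ S → φ x = 0) →
      ∫⁻ x in U, ‖φ x‖ₑ ≤ C * volume S ^ (1 / (n : ℝ)) * ∫⁻ x in U, ‖H x‖ₑ := by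
  obtain ⟨χ, C, hχ1, hχn, hC⟩ := exists_eLpNorm_le_eLpNorm_fderiv hn
  refine ⟨C, fun p U S φ H ψ hp hUf h hφ hH hS => ?_⟩
  have hp1 : 1 ≤ ENNReal.ofReal p := by simpa using ENNReal.ofReal_le_ofReal hp.le
  have hP0 : ENNReal.ofReal p ≠ 0 := (one_pos.trans_le hp1).ne'
  have : IsFiniteMeasure (volume.restrict U) := ⟨by simpa using hUf⟩
  have hψm : ∀ k, AEStronglyMeasurable (ψ k) (volume.restrict U) := fun k =>
    (h.test k).1.continuous.aestronglyMeasurable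
  have hgm : ∀ k, AEStronglyMeasurable (gradient (ψ k)) (volume.restrict U) := fun k =>
    (continuous_gradient (h.test k).1).aestronglyMeasurable
  have hlim : eLpNorm φ χ (volume.restrict U) ≤ C * eLpNorm H 1 (volume.restrict U) := by
    obtain ⟨ns, hns, hae⟩ :=
      (tendstoInMeasure_of_tendsto_eLpNorm hP0 hψm hφ h.tendsto).exists_seq_tendsto_ae
    have h1 := (tendsto_eLpNorm_one_of_tendsto_eLpNorm hp1 (fun k => (hgm k).sub hH)
      h.tendsto_gradient).comp hns.tendsto_atTop
    have h2 : Tendsto (fun k => C * (eLpNorm (fun x => gradient (ψ (ns k)) x - H x) 1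
        (volume.restrict U) + eLpNorm H 1 (volume.restrict U))) atTop
        (𝓝 (C * (0 + eLpNorm H 1 (volume.restrict U)))) :=
      ENNReal.Tendsto.const_mul (h1.add_const _) (Or.inr ENNReal.coe_ne_top)
    rw [zero_add] at h2
    -- Fatou along an almost everywhere convergent subsequence, which avoids proving convergence in
    -- `L^χ`.
    refine (Lp.eLpNorm_lim_le_liminf_eLpNorm (fun k => hψm (ns k)) φ hae).trans ?_
    rw [← h2.liminf_eq]
    refine liminf_le_liminf (Eventually.of_forall fun k => ?_)
    have hs : Function.support (fderiv ℝ (ψ (ns k))) ⊆ U :=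
      (support_fderiv_subset ℝ).trans (h.test (ns k)).2.2
    calc eLpNorm (ψ (ns k)) χ (volume.restrict U) ≤ eLpNorm (ψ (ns k)) χ volume :=
          eLpNorm_mono_measure _ Measure.restrict_le_self
      _ ≤ C * eLpNorm (fderiv ℝ (ψ (ns k))) 1 volume :=
          hC _ ((h.test (ns k)).1.of_le (by exact_mod_cast le_top)) (h.test (ns k)).2.1
      _ = C * eLpNorm (gradient (ψ (ns k))) 1 (volume.restrict U) := by
          rw [← eLpNorm_restrict_eq_of_support_subset (f := fderiv ℝ (ψ (ns k))) hs]
          congr 1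
          exact eLpNorm_congr_norm_ae
            (Eventually.of_forall fun x => (norm_gradient (ψ (ns k)) x).symm)
      _ ≤ _ := by
          gcongr
          have e : gradient (ψ (ns k)) = (fun x => gradient (ψ (ns k)) x - H x) + H := by
            ext x; simp
          conv_lhs => rw [e]
          exact eLpNorm_add_le ((hgm (ns k)).sub hH) hH le_rfl
  have hsupp : Function.support φ ⊆ S := fun x hx => by
    by_contra hxS
    exact hx (hS x hxS)
  rw [← eLpNorm_one_eq_lintegral_enorm, ← eLpNorm_one_eq_lintegral_enorm,
    ← eLpNorm_restrict_eq_of_support_subset hsupp]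
  -- Hölder on `S` passes from `L^χ` to `L^1` at the cost of the factor `|S|^(1 - 1/χ) = |S|^(1/n)`.
  refine (eLpNorm_le_eLpNorm_mul_rpow_measure_univ hχ1 hφ.restrict).trans ?_
  rw [eLpNorm_restrict_eq_of_support_subset hsupp, Measure.restrict_apply_univ]
  simp only [ENNReal.toReal_one, ne_eq, one_ne_zero, not_false_eq_true, div_self]
  rw [hχn]
  calc eLpNorm φ χ (volume.restrict U) * (volume.restrict U) S ^ (1 / (n : ℝ))
      ≤ (C * eLpNorm H 1 (volume.restrict U)) * volume S ^ (1 / (n : ℝ)) := by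
        gcongr
        exact Measure.restrict_le_self
    _ = _ := by ring

end Sobolev

/-! ### The truncated kernel and lower bounds for nonlocal integrals -/

section Kernel

variable {n : ℕ}

/-- The weight `min(|z|/r, 1)^p |z|^{-(n+ps)}`. -/
noncomputable def truncatedKernel (n : ℕ) (p s r : ℝ) (z : Eucl n) : ℝ :=
  min (‖z‖ / r) 1 ^ p / ‖z‖ ^ ((n : ℝ) + p * s)

theorem truncatedKernel_nonneg {p s r : ℝ} (hr : 0 < r) (z : Eucl n) :
    0 ≤ truncatedKernel n p s r z := by
  unfold truncatedKernel
  positivity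

theorem truncatedKernel_neg (p s r : ℝ) (z : Eucl n) :
    truncatedKernel n p s r (-z) = truncatedKernel n p s r z := by
  simp [truncatedKernel]

theorem truncatedKernel_eq_smul {p s r : ℝ} (hr : 0 < r) (z : Eucl n) :
    truncatedKernel n p s r z =
      (r ^ ((n : ℝ) + p * s))⁻¹ * truncatedKernel n p s 1 (r⁻¹ • z) := by
  unfold truncatedKernel
  rw [norm_smul, Real.norm_of_nonneg (by positivity), div_one, inv_mul_eq_div r ‖z‖,
    Real.div_rpow (norm_nonneg z) hr.le]
  have : 0 < r ^ ((n : ℝ) + p * s) := Real.rpow_pos_of_pos hr _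
  field_simp

/-- In polar coordinates the integrand is `y^(p - ps - 1)` near zero, integrable since `s < 1`, and
`y^(-1 - ps)` at infinity, integrable since `s > 0`. -/
theorem integrable_truncatedKernel_one (hn : 1 ≤ n) {p s : ℝ} (hp : 1 < p) (hs0 : 0 < s)
    (hs1 : s < 1) : Integrable (truncatedKernel n p s 1) := by
  have : Nonempty (Fin n) := ⟨⟨0, hn⟩⟩
  have hps : 0 < p * s := by positivity
  have hps1 : p * s < p := by nlinarith
  have h : Integrable (fun z : Eucl n =>
      (fun y : ℝ => min (y / 1) 1 ^ p / y ^ ((n : ℝ) + p * s)) ‖z‖) volume := by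
    refine (integrable_fun_norm_addHaar volume
      (f := fun y : ℝ => min (y / 1) 1 ^ p / y ^ ((n : ℝ) + p * s))).2 ?_
    rw [finrank_euclideanSpace, Fintype.card_fin,
      ← Set.Ioc_union_Ioi_eq_Ioi (zero_le_one (α := ℝ))]
    have e : ∀ y : ℝ, 0 < y → y ^ (n - 1) = y ^ ((n : ℝ) - 1) := fun y hy => by
      rw [← Real.rpow_natCast, Nat.cast_sub hn, Nat.cast_one]
    refine IntegrableOn.union ?_ ?_
    · have h1 : IntegrableOn (fun y : ℝ => y ^ (p - p * s - 1)) (Set.Ioc 0 1) :=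
        (intervalIntegrable_iff_integrableOn_Ioc_of_le zero_le_one).1
          (intervalIntegral.intervalIntegrable_rpow' (by linarith))
      refine h1.congr_fun (fun y hy => ?_) measurableSet_Ioc
      simp only [div_one, min_eq_left hy.2, smul_eq_mul]
      rw [e y hy.1, ← Real.rpow_sub hy.1, ← Real.rpow_add hy.1]
      congr 1
      ring
    · have h1 : IntegrableOn (fun y : ℝ => y ^ (-1 - p * s)) (Set.Ioi 1) :=
        integrableOn_Ioi_rpow_of_lt (by linarith) one_pos
      refine h1.congr_fun (fun y hy => ?_) measurableSet_Ioi
      have hy1 : 1 < y := hy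
      have hy0 : 0 < y := one_pos.trans hy1
      simp only [div_one, min_eq_right hy1.le, smul_eq_mul, Real.one_rpow]
      rw [e y hy0, ← Real.rpow_zero y, ← Real.rpow_sub hy0, ← Real.rpow_add hy0]
      congr 1
      ring
  exact h

theorem integrable_truncatedKernel (hn : 1 ≤ n) {p s r : ℝ} (hp : 1 < p) (hs0 : 0 < s)
    (hs1 : s < 1) (hr : 0 < r) : Integrable (truncatedKernel n p s r) := by
  have h := ((integrable_truncatedKernel_one hn hp hs0 hs1).comp_smul
    (inv_ne_zero hr.ne')).const_mul ((r ^ ((n : ℝ) + p * s))⁻¹)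
  exact h.congr (Eventually.of_forall fun z => (truncatedKernel_eq_smul hr z).symm)

/-- Rescaling by `r` gives the factor `r^n · r^(-(n + ps))`, the natural scaling of the nonlocal
term. -/
theorem integral_truncatedKernel {p s r : ℝ} (hr : 0 < r) :
    ∫ z, truncatedKernel n p s r z = r ^ (-(p * s)) * ∫ z, truncatedKernel n p s 1 z := by
  simp_rw [truncatedKernel_eq_smul hr]
  rw [integral_const_mul, Measure.integral_comp_inv_smul_of_nonneg _ _ hr.le,
    finrank_euclideanSpace, Fintype.card_fin, smul_eq_mul, ← mul_assoc]
  congr 1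
  rw [Real.rpow_add hr, Real.rpow_natCast, Real.rpow_neg hr.le]
  have : r ^ n ≠ 0 := by positivity
  have : r ^ (p * s) ≠ 0 := (Real.rpow_pos_of_pos hr _).ne'
  field_simp

theorem integrable_indicator_mul_comp_sub {A : Set (Eucl n)} (hA : MeasurableSet A)
    (hAf : volume A ≠ ⊤) {J : Eucl n → ℝ} (hJ : Integrable J) :
    Integrable (fun z : Eucl n × Eucl n => A.indicator (fun _ => (1 : ℝ)) z.2 * J (z.1 - z.2))
      (volume.prod volume) :=
  Integrable.convolution_integrand (ContinuousLinearMap.mul ℝ ℝ)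
    ((integrable_indicator_iff hA).2 (integrableOn_const hAf)) hJ

theorem integral_indicator_mul_comp_sub {A : Set (Eucl n)} (hA : MeasurableSet A)
    (hAf : volume A ≠ ⊤) {J : Eucl n → ℝ} (hJ : Integrable J) :
    ∫ z : Eucl n × Eucl n, A.indicator (fun _ => (1 : ℝ)) z.2 * J (z.1 - z.2)
      ∂(volume.prod volume) = volume.real A * ∫ z, J z := by
  rw [integral_prod_symm _ (integrable_indicator_mul_comp_sub hA hAf hJ)]
  simp_rw [integral_const_mul, integral_sub_right_eq_self J, integral_mul_const]
  rw [integral_indicator hA, setIntegral_const, smul_eq_mul, mul_one]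

/-- A function on the product that is bounded below by `-(1_A(x) + 1_A(y)) J(x - y)` has integral
at least `-2 |A| ∫ J`. Integrability of `f` is not needed: if it fails, the integral is zero by
convention, which respects the bound. -/
theorem neg_le_integral_of_neg_indicator_le {A : Set (Eucl n)} (hA : MeasurableSet A)
    (hAf : volume A ≠ ⊤) {J : Eucl n → ℝ} (hJ : Integrable J) (hJ0 : ∀ z, 0 ≤ J z)
    (hJs : ∀ z, J (-z) = J z) {f : Eucl n × Eucl n → ℝ}
    (hf : ∀ x y, -((A.indicator (fun _ => (1 : ℝ)) x + A.indicator (fun _ => (1 : ℝ)) y) *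
      J (x - y)) ≤ f (x, y)) :
    -(2 * volume.real A * ∫ z, J z) ≤ ∫ z, f z ∂(volume.prod volume) := by
  have i1 := integrable_indicator_mul_comp_sub hA hAf hJ
  have e1 := integral_indicator_mul_comp_sub hA hAf hJ
  have i2 := i1.swap
  have e2 := integral_prod_swap (μ := volume) (ν := volume)
    (fun z : Eucl n × Eucl n => A.indicator (fun _ => (1 : ℝ)) z.2 * J (z.1 - z.2))
  have hE : ∀ z : Eucl n × Eucl n,
      (A.indicator (fun _ => (1 : ℝ)) z.1 + A.indicator (fun _ => (1 : ℝ)) z.2) * J (z.1 - z.2) =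
      ((fun z : Eucl n × Eucl n => A.indicator (fun _ => (1 : ℝ)) z.2 * J (z.1 - z.2)) ∘
        Prod.swap) z + A.indicator (fun _ => (1 : ℝ)) z.2 * J (z.1 - z.2) := by
    intro z
    simp only [Function.comp_apply, Prod.fst_swap, Prod.snd_swap]
    rw [← hJs (z.2 - z.1), neg_sub]
    ring
  have iE : Integrable (fun z : Eucl n × Eucl n =>
      (A.indicator (fun _ => (1 : ℝ)) z.1 + A.indicator (fun _ => (1 : ℝ)) z.2) *
        J (z.1 - z.2)) (volume.prod volume) :=
    (i2.add i1).congr (Eventually.of_forall fun z => (hE z).symm)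
  have eE : ∫ z : Eucl n × Eucl n,
      (A.indicator (fun _ => (1 : ℝ)) z.1 + A.indicator (fun _ => (1 : ℝ)) z.2) *
        J (z.1 - z.2) ∂(volume.prod volume) = 2 * volume.real A * ∫ z, J z := by
    simp_rw [hE]
    rw [integral_add i2 i1, e1]
    simp only [Function.comp_apply]
    rw [e2, e1]
    ring
  by_cases hfi : Integrable f (volume.prod volume)
  · rw [← eE, ← integral_neg]
    exact integral_mono iE.neg hfi fun z => hf z.1 z.2
  · rw [integral_undef hfi, neg_nonpos]
    have := integral_nonneg (μ := volume) (f := J) hJ0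
    positivity

end Kernel

/-! ### Pointwise inequalities for the two energies -/

section Pointwise

theorem abs_rpow_sub_two_mul_self {d p : ℝ} (hd : 0 ≤ d) (hp : 1 < p) :
    |d| ^ (p - 2) * d = d ^ (p - 1) := by
  rcases hd.eq_or_lt with rfl | hd
  · rw [mul_zero, Real.zero_rpow (by linarith)]
  · rw [abs_of_pos hd]
    nth_rewrite 2 [← Real.rpow_one d]
    rw [← Real.rpow_add hd]
    congr 1
    ring

/-- If the increment `a` of `u` is nonnegative and `b` is the increment of the barrier, then the
test function decreases by at most the increment of the barrier. -/
theorem neg_le_rpow_mul_sub {p C L D m a b φx φy : ℝ} (hp : 1 < p) (hC : 0 ≤ C)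
    (hD : 0 ≤ D) (hm : 0 ≤ m) (ha : 0 ≤ a) (haL : a ≤ 2 * L) (hab : a ≤ b)
    (hφ : φy - φx ≤ C * (b - a)) (hφ1 : φy - φx ≤ 1) (hb : m ≤ 1 → b ≤ D * m) :
    -((C * D ^ p + (2 * L) ^ (p - 1)) * min m 1 ^ p) ≤ a ^ (p - 1) * (φx - φy) := by
  have hp0 : 0 < p := by linarith
  have h0 : 0 ≤ a ^ (p - 1) := Real.rpow_nonneg ha _
  have hL : 0 ≤ 2 * L := ha.trans haL
  suffices a ^ (p - 1) * (φy - φx) ≤ (C * D ^ p + (2 * L) ^ (p - 1)) * min m 1 ^ p by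
    linarith [mul_sub (a ^ (p - 1)) φx φy, mul_sub (a ^ (p - 1)) φy φx]
  have h2L : 0 ≤ (2 * L) ^ (p - 1) := Real.rpow_nonneg hL _
  have hDp : 0 ≤ D ^ p := Real.rpow_nonneg hD _
  rcases le_total m 1 with hm1 | hm1
  · rw [min_eq_left hm1]
    have hb' := hb hm1
    have hDm : 0 ≤ D * m := by positivity
    calc a ^ (p - 1) * (φy - φx) ≤ a ^ (p - 1) * (C * (D * m)) := by
          refine mul_le_mul_of_nonneg_left (hφ.trans ?_) h0
          exact mul_le_mul_of_nonneg_left (by linarith) hC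
      _ ≤ (D * m) ^ (p - 1) * (C * (D * m)) := by
          refine mul_le_mul_of_nonneg_right ?_ (by positivity)
          exact Real.rpow_le_rpow ha (hab.trans hb') (by linarith)
      _ = C * (D * m) ^ p := by
          rcases hDm.eq_or_lt with h | h
          · rw [← h, Real.zero_rpow hp0.ne']; ring
          · rw [Real.rpow_sub_one h.ne', mul_left_comm, div_mul_cancel₀ _ h.ne']
      _ = C * D ^ p * m ^ p := by rw [Real.mul_rpow hD hm]; ring
      _ ≤ _ := by
          refine mul_le_mul_of_nonneg_right ?_ (Real.rpow_nonneg hm _)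
          linarith
  · rw [min_eq_right hm1, Real.one_rpow, mul_one]
    calc a ^ (p - 1) * (φy - φx) ≤ a ^ (p - 1) * 1 := mul_le_mul_of_nonneg_left hφ1 h0
      _ ≤ (2 * L) ^ (p - 1) := by
          rw [mul_one]
          exact Real.rpow_le_rpow ha haL (by linarith)
      _ ≤ _ := by
          have : 0 ≤ C * D ^ p := by positivity
          linarith

variable {E : Type*} [NormedAddCommGroup E] [InnerProductSpace ℝ E]

theorem norm_rpow_mul_inner_le {p : ℝ} (a b : E) :
    |‖a‖ ^ (p - 2) * inner ℝ a b| ≤ ‖a‖ ^ (p - 1) * ‖b‖ := by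
  rcases eq_or_ne a 0 with rfl | ha
  · simp only [inner_zero_left, mul_zero, abs_zero]
    positivity
  · have hN : 0 < ‖a‖ := norm_pos_iff.2 ha
    rw [abs_mul, abs_of_nonneg (Real.rpow_nonneg hN.le _)]
    calc ‖a‖ ^ (p - 2) * |inner ℝ a b| ≤ ‖a‖ ^ (p - 2) * (‖a‖ * ‖b‖) := by
          gcongr
          exact abs_real_inner_le_norm a b
      _ = ‖a‖ ^ (p - 1) * ‖b‖ := by
          rw [← mul_assoc]
          congr 1
          nth_rewrite 2 [← Real.rpow_one ‖a‖]
          rw [← Real.rpow_add hN]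
          congr 1
          ring

theorem rpow_sub_one_mul_le_rpow_add_rpow {p a b : ℝ} (hp : 1 < p) (ha : 0 ≤ a) (hb : 0 ≤ b) :
    a ^ (p - 1) * b ≤ a ^ p + b ^ p := by
  have key : ∀ {c : ℝ}, 0 ≤ c → c ^ (p - 1) * c = c ^ p := fun hc => by
    rcases hc.eq_or_lt with rfl | hc
    · rw [Real.zero_rpow (by linarith : p ≠ 0), mul_zero]
    · rw [Real.rpow_sub_one hc.ne']
      field_simp
  rcases le_total a b with h | h
  · calc a ^ (p - 1) * b ≤ b ^ (p - 1) * b := by gcongr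
      _ = b ^ p := key hb
      _ ≤ _ := by linarith [Real.rpow_nonneg ha p]
  · calc a ^ (p - 1) * b ≤ a ^ (p - 1) * a := by gcongr
      _ = a ^ p := key ha
      _ ≤ _ := by linarith [Real.rpow_nonneg hb p]

/-- Coercivity of the local term tested with `τ (a - P)`. -/
theorem le_norm_rpow_mul_inner_smul_sub {p r D τ : ℝ} (hp : 1 < p) (hr : 0 < r)
    (hD : 0 ≤ D) (hτ : 0 ≤ τ) {a P : E} (hP : ‖P‖ ≤ D / r) :
    1 / 2 * r ^ (1 - p) * ‖τ • (a - P)‖ -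
      τ * ((D / 2 + 1 / 2 + 2 ^ (p - 1) * D ^ p) * r ^ (-p)) ≤
      ‖a‖ ^ (p - 2) * inner ℝ a (τ • (a - P)) := by
  have hp0 : 0 < p := by linarith
  rw [inner_smul_right, norm_smul, Real.norm_of_nonneg hτ]
  suffices h : 1 / 2 * r ^ (1 - p) * ‖a - P‖ - (D / 2 + 1 / 2 + 2 ^ (p - 1) * D ^ p) * r ^ (-p) ≤
      ‖a‖ ^ (p - 2) * inner ℝ a (a - P) by
    have := mul_le_mul_of_nonneg_left h hτ
    linarith
  set N := ‖a‖ with hN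
  set Q := ‖P‖ with hQ
  have hN0 : 0 ≤ N := norm_nonneg a
  have hQ0 : 0 ≤ Q := norm_nonneg P
  have h1 : N ^ p - N ^ (p - 1) * Q ≤ N ^ (p - 2) * inner ℝ a (a - P) := by
    have h2 := (abs_le.1 (norm_rpow_mul_inner_le (p := p) a P)).2
    have h3 : N ^ (p - 2) * inner ℝ a a = N ^ p := by
      rw [real_inner_self_eq_norm_sq, ← hN]
      rcases hN0.eq_or_lt with h | h
      · rw [← h, Real.zero_rpow hp0.ne']; ring
      · rw [← Real.rpow_natCast, ← Real.rpow_add h]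
        congr 1
        norm_num
    rw [inner_sub_right, mul_sub, h3]
    linarith
  -- Young's inequality with explicit constants: either `Q ≤ N / 2`, or `N` is at most `2 Q`.
  have h2 : N ^ (p - 1) * Q ≤ 1 / 2 * N ^ p + 2 ^ (p - 1) * Q ^ p := by
    have hc : 0 ≤ (2 : ℝ) ^ (p - 1) * Q ^ p := by positivity
    have hNp : 0 ≤ N ^ p := Real.rpow_nonneg hN0 _
    have key : ∀ {c : ℝ}, 0 ≤ c → c ^ (p - 1) * c = c ^ p := fun hc => by
      rcases hc.eq_or_lt with rfl | hc
      · rw [Real.zero_rpow hp0.ne', mul_zero]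
      · rw [Real.rpow_sub_one hc.ne']
        field_simp
    rcases le_total Q (N / 2) with h | h
    · have := mul_le_mul_of_nonneg_left h (Real.rpow_nonneg hN0 (p - 1))
      have := key hN0
      linarith
    · calc N ^ (p - 1) * Q ≤ (2 * Q) ^ (p - 1) * Q := by
            gcongr ?_ * Q
            exact Real.rpow_le_rpow hN0 (by linarith) (by linarith)
        _ = 2 ^ (p - 1) * Q ^ p := by
            rw [Real.mul_rpow zero_le_two hQ0, mul_assoc, key hQ0]
        _ ≤ _ := by linarith
  -- This is `t - 1 ≤ t^p` at `t = r N`, divided by `r^p`. It trades the `p`-energy for the first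
  -- power of the gradient, which is all that the `W^{1,1}` inequality needs.
  have h3 : r ^ (1 - p) * N - r ^ (-p) ≤ N ^ p := by
    have e : r ^ (1 - p) = r ^ (-p) * r := by
      rw [sub_eq_add_neg, Real.rpow_add hr, Real.rpow_one, mul_comm]
    have hrp : 0 < r ^ (-p) := Real.rpow_pos_of_pos hr _
    rcases le_total (r * N) 1 with h | h
    · have : r ^ (-p) * (r * N) ≤ r ^ (-p) * 1 := by gcongr
      have := Real.rpow_nonneg hN0 p
      rw [e]
      linarith
    · have h4 : (r * N) ≤ (r * N) ^ p := by
        nth_rewrite 1 [← Real.rpow_one (r * N)]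
        exact Real.rpow_le_rpow_of_exponent_le h hp.le
      rw [Real.mul_rpow hr.le hN0] at h4
      have h5 := mul_le_mul_of_nonneg_left h4 hrp.le
      rw [← mul_assoc (r ^ (-p)) (r ^ p), ← Real.rpow_add hr, neg_add_cancel, Real.rpow_zero,
        one_mul] at h5
      rw [e]
      linarith
  have h4 : Q ^ p ≤ D ^ p * r ^ (-p) := by
    rw [Real.rpow_neg hr.le, ← div_eq_mul_inv, ← Real.div_rpow hD hr.le]
    exact Real.rpow_le_rpow hQ0 hP hp0.le
  have h5 : ‖a - P‖ ≤ N + D / r := (norm_sub_le a P).trans (by linarith)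
  have h6 : r ^ (1 - p) * (D / r) = D * r ^ (-p) := by
    rw [sub_eq_add_neg, Real.rpow_add hr, Real.rpow_one]
    field_simp
  have h7 : r ^ (1 - p) * ‖a - P‖ ≤ r ^ (1 - p) * (N + D / r) :=
    mul_le_mul_of_nonneg_left h5 (Real.rpow_nonneg hr.le _)
  have h8 : (2 : ℝ) ^ (p - 1) * Q ^ p ≤ 2 ^ (p - 1) * (D ^ p * r ^ (-p)) := by gcongr
  linarith

end Pointwise

/-! ### The nonlocal integrand -/

section Nonlocal

variable {n : ℕ}

/-- By symmetry take `u y ≤ u x`. The integrand can be negative only when `u - g` is larger at `y`,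
with `y` in the superlevel set; then the increment of `u` is below that of `g`, and
`neg_le_rpow_mul_sub` gives a bound of order `min (|x - y| / r) 1 ^ p`, integrable against the
kernel. No regularity of `u` enters. -/
theorem neg_indicator_le_nonlocal_integrand {p s Λ L r C D : ℝ} (hp : 1 < p) (hr : 0 < r)
    (hC : 0 ≤ C) (hD : 0 ≤ D) (hΛ : 0 ≤ Λ) {K : Eucl n → Eucl n → ℝ} (hK : IsKernel p s Λ K)
    {u g : Eucl n → ℝ} (huL : ∀ x, |u x| ≤ L)
    (hg : ∀ x y, 0 < u y - g y → ‖x - y‖ / r ≤ 1 → |g x - g y| ≤ D * (‖x - y‖ / r))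
    {T : ℝ → ℝ} (hTm : Monotone T) (hT0 : ∀ t ≤ 0, T t = 0) (hT1 : ∀ t, T t ≤ 1)
    (hTl : ∀ a b, |T a - T b| ≤ C * |a - b|) (x y : Eucl n) :
    -(({x | 0 < u x - g x}.indicator (fun _ => (1 : ℝ)) x +
        {x | 0 < u x - g x}.indicator (fun _ => (1 : ℝ)) y) *
      ((C * D ^ p + (2 * L) ^ (p - 1)) * Λ * truncatedKernel n p s r (x - y))) ≤
    |u x - u y| ^ (p - 2) * (u x - u y) * (T (u x - g x) - T (u y - g y)) * K x y := by
  set A := {x | 0 < u x - g x} with hA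
  have hL : 0 ≤ 2 * L := by linarith [(abs_nonneg _).trans (huL x)]
  have hB : 0 ≤ C * D ^ p + (2 * L) ^ (p - 1) := by positivity
  have hi0 : ∀ x, 0 ≤ A.indicator (fun _ => (1 : ℝ)) x := fun x =>
    Set.indicator_nonneg (fun _ _ => zero_le_one) x
  have hJ0 : ∀ z, 0 ≤ (C * D ^ p + (2 * L) ^ (p - 1)) * Λ * truncatedKernel n p s r z := fun z =>
    mul_nonneg (mul_nonneg hB hΛ) (truncatedKernel_nonneg hr z)
  have main : ∀ x y, u y ≤ u x →
      -(A.indicator (fun _ => (1 : ℝ)) y *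
        ((C * D ^ p + (2 * L) ^ (p - 1)) * Λ * truncatedKernel n p s r (x - y))) ≤
      |u x - u y| ^ (p - 2) * (u x - u y) * (T (u x - g x) - T (u y - g y)) * K x y := by
    intro x y hxy
    rcases eq_or_ne x y with rfl | hne
    · simp only [sub_self, mul_zero, zero_mul, neg_nonpos]
      exact mul_nonneg (hi0 _) (hJ0 _)
    have hpos : 0 < ‖x - y‖ ^ ((n : ℝ) + p * s) :=
      Real.rpow_pos_of_pos (norm_pos_iff.2 (sub_ne_zero.2 hne)) _
    have hK0 : 0 ≤ K x y := by
      refine le_trans ?_ (hK.lower x y hne)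
      positivity
    rw [abs_rpow_sub_two_mul_self (sub_nonneg.2 hxy) hp]
    have hd : 0 ≤ (u x - u y) ^ (p - 1) := Real.rpow_nonneg (sub_nonneg.2 hxy) _
    rcases le_or_gt (T (u y - g y)) (T (u x - g x)) with hT | hT
    · refine le_trans (neg_nonpos.2 (mul_nonneg (hi0 _) (hJ0 _))) ?_
      exact mul_nonneg (mul_nonneg hd (sub_nonneg.2 hT)) hK0
    have hv : u x - g x < u y - g y := hTm.reflect_lt hT
    have hTx : 0 ≤ T (u x - g x) := by
      rcases le_total 0 (u x - g x) with h | h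
      · rw [← hT0 0 le_rfl]; exact hTm h
      · rw [hT0 _ h]
    have hyA : y ∈ A := by
      by_contra hy
      have : u y - g y ≤ 0 := not_lt.1 hy
      rw [hT0 _ this] at hT
      linarith
    rw [Set.indicator_of_mem hyA, one_mul]
    have hF := neg_le_rpow_mul_sub (p := p) (C := C) (L := L) (D := D) (m := ‖x - y‖ / r)
      (a := u x - u y) (b := g x - g y) (φx := T (u x - g x)) (φy := T (u y - g y))
      hp hC hD (by positivity) (sub_nonneg.2 hxy)
      (by linarith [(abs_le.1 (huL x)).2, (abs_le.1 (huL y)).1]) (by linarith)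
      (by
        have := (le_abs_self _).trans (hTl (u y - g y) (u x - g x))
        rw [abs_of_pos (sub_pos.2 hv)] at this
        rwa [show g x - g y - (u x - u y) = u y - g y - (u x - g x) by ring])
      (by linarith [hT1 (u y - g y)])
      (fun h => (le_abs_self _).trans (hg x y hyA h))
    refine le_trans ?_ (mul_le_mul_of_nonneg_right hF hK0)
    rw [neg_mul]
    refine neg_le_neg ?_
    have hm : 0 ≤ min (‖x - y‖ / r) 1 ^ p := by positivity
    calc (C * D ^ p + (2 * L) ^ (p - 1)) * min (‖x - y‖ / r) 1 ^ p * K x y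
        ≤ (C * D ^ p + (2 * L) ^ (p - 1)) * min (‖x - y‖ / r) 1 ^ p *
          (Λ / ‖x - y‖ ^ ((n : ℝ) + p * s)) := by
          gcongr
          exact hK.upper x y hne
      _ = _ := by
          unfold truncatedKernel
          ring
  rcases le_total (u y) (u x) with h | h
  · refine le_trans ?_ (main x y h)
    rw [add_mul, neg_add]
    linarith [mul_nonneg (hi0 x) (hJ0 (x - y))]
  · have e := main y x h
    rw [abs_sub_comm, hK.symm y x, ← neg_sub x y, truncatedKernel_neg] at e
    have e2 : |u x - u y| ^ (p - 2) * (u y - u x) * (T (u y - g y) - T (u x - g x)) * K x y =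
      |u x - u y| ^ (p - 2) * (u x - u y) * (T (u x - g x) - T (u y - g y)) * K x y := by ring
    rw [e2] at e
    refine le_trans ?_ e
    rw [add_mul, neg_add]
    linarith [mul_nonneg (hi0 y) (hJ0 (x - y))]

end Nonlocal

/-! ### Derivative of the smooth step -/

section SmoothTransition

theorem deriv_smoothTransition_of_nonpos {t : ℝ} (ht : t ≤ 0) :
    deriv Real.smoothTransition t = 0 := by
  refine IsLocalMin.deriv_eq_zero (Eventually.of_forall fun x => ?_)
  rw [Real.smoothTransition.zero_of_nonpos ht]
  exact Real.smoothTransition.nonneg x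

theorem exists_abs_deriv_smoothTransition_le :
    ∃ C : ℝ, 0 < C ∧ ∀ t, |deriv Real.smoothTransition t| ≤ C := by
  have hc : Continuous (deriv Real.smoothTransition) :=
    (Real.smoothTransition.contDiff (n := 1)).continuous_deriv (by simp)
  obtain ⟨C, hC⟩ := (isCompact_Icc (a := (0 : ℝ)) (b := 1)).exists_bound_of_continuousOn
    hc.continuousOn
  refine ⟨max C 1, by positivity, fun t => ?_⟩
  rcases le_or_gt t 0 with h0 | h0
  · rw [deriv_smoothTransition_of_nonpos h0, abs_zero]
    positivity
  rcases le_or_gt 1 t with h1 | h1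
  · have : deriv Real.smoothTransition t = 0 := by
      refine IsLocalMax.deriv_eq_zero (Eventually.of_forall fun x => ?_)
      rw [Real.smoothTransition.one_of_one_le h1]
      exact Real.smoothTransition.le_one x
    rw [this, abs_zero]
    positivity
  · exact (hC t ⟨h0.le, h1.le⟩).trans (le_max_left _ _)

theorem deriv_smoothTransition_div (δ t : ℝ) :
    deriv (fun t => Real.smoothTransition (t / δ)) t =
      deriv Real.smoothTransition (t / δ) / δ := by
  have h1 : HasDerivAt Real.smoothTransition (deriv Real.smoothTransition (t / δ)) (t / δ) :=
    ((Real.smoothTransition.contDiff (n := 1)).differentiable (by simp) _).hasDerivAt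
  have h2 := h1.comp t ((hasDerivAt_id t).div_const δ)
  have h3 : HasDerivAt (fun t => Real.smoothTransition (t / δ)) _ t := h2
  rw [h3.deriv]
  ring

end SmoothTransition

/-! ### The quadratic barrier -/

section Barrier

variable {n : ℕ}

/-- The barrier `κ |x - x₀|² / r²`. -/
noncomputable def barrier (κ r : ℝ) (x₀ x : Eucl n) : ℝ := κ * ‖x - x₀‖ ^ 2 / r ^ 2

theorem contDiff_barrier_add (κ r k : ℝ) (x₀ : Eucl n) :
    ContDiff ℝ ∞ fun x => barrier κ r x₀ x + k := by
  unfold barrier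
  exact ((contDiff_const.mul ((contDiff_id.sub contDiff_const).norm_sq ℝ)).div_const _).add
    contDiff_const

theorem norm_gradient_barrier_add_le {κ r : ℝ} (hκ : 0 ≤ κ) (hr : 0 < r) (k : ℝ)
    {x₀ x : Eucl n} (hx : x ∈ Metric.ball x₀ r) :
    ‖gradient (fun x => barrier κ r x₀ x + k) x‖ ≤ 2 * κ / r := by
  have e : gradient (fun x => barrier κ r x₀ x + k) x = (2 * κ / r ^ 2) • (x - x₀) := by
    apply gradient_eq_of_fderiv_apply
    intro v
    have h1 : HasFDerivAt (fun x : Eucl n => x - x₀) (ContinuousLinearMap.id ℝ (Eucl n)) x :=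
      (hasFDerivAt_id x).sub_const x₀
    have h2 := ((h1.norm_sq.const_mul κ).mul_const (r ^ 2)⁻¹).add_const k
    have h3 : HasFDerivAt (fun x => barrier κ r x₀ x + k) _ x := h2
    rw [h3.fderiv]
    simp [inner_smul_left]
    rw [inner_sub_left]
    ring
  rw [e, norm_smul, Real.norm_of_nonneg (by positivity)]
  have : ‖x - x₀‖ ≤ r := (mem_ball_iff_norm.1 hx).le
  calc 2 * κ / r ^ 2 * ‖x - x₀‖ ≤ 2 * κ / r ^ 2 * r := by gcongr
    _ = 2 * κ / r := by field_simp

/-- Factor the difference of squares: `y` lies within `r` of the center and `x` within `2 r`, so the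
sum of the norms is at most `3 r`. -/
theorem abs_barrier_sub_le {κ r : ℝ} (hκ : 0 ≤ κ) (hr : 0 < r) {x₀ x y : Eucl n}
    (hy : y ∈ Metric.ball x₀ r) (hxy : ‖x - y‖ / r ≤ 1) :
    |barrier κ r x₀ x - barrier κ r x₀ y| ≤ 3 * κ * (‖x - y‖ / r) := by
  have h1 : ‖y - x₀‖ ≤ r := (mem_ball_iff_norm.1 hy).le
  have h2 : ‖x - y‖ ≤ r := by rwa [div_le_one hr] at hxy
  have h3 : ‖x - x₀‖ ≤ 2 * r := by
    have := norm_add_le (x - y) (y - x₀)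
    rw [sub_add_sub_cancel] at this
    linarith
  have h4 : |‖x - x₀‖ - ‖y - x₀‖| ≤ ‖x - y‖ := by
    have := abs_norm_sub_norm_le (x - x₀) (y - x₀)
    rwa [sub_sub_sub_cancel_right] at this
  have e : barrier κ r x₀ x - barrier κ r x₀ y =
      κ / r ^ 2 * ((‖x - x₀‖ - ‖y - x₀‖) * (‖x - x₀‖ + ‖y - x₀‖)) := by
    unfold barrier; ring
  rw [e, abs_mul, abs_mul, abs_of_nonneg (show 0 ≤ κ / r ^ 2 by positivity),
    abs_of_nonneg (show 0 ≤ ‖x - x₀‖ + ‖y - x₀‖ by positivity)]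
  calc κ / r ^ 2 * (|‖x - x₀‖ - ‖y - x₀‖| * (‖x - x₀‖ + ‖y - x₀‖))
      ≤ κ / r ^ 2 * (‖x - y‖ * (3 * r)) := by
        gcongr
        linarith
    _ = _ := by field_simp

theorem le_barrier_of_notMem_ball {κ r : ℝ} (hκ : 0 ≤ κ) (hr : 0 < r) {x₀ x : Eucl n}
    (hx : x ∉ Metric.ball x₀ r) : κ ≤ barrier κ r x₀ x := by
  have h : r ≤ ‖x - x₀‖ := by
    rw [mem_ball_iff_norm] at hx
    exact not_lt.1 hx
  unfold barrier
  rw [le_div_iff₀ (by positivity)]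
  gcongr

end Barrier

/-! ### Energy estimate and De Giorgi iteration -/

section LevelSets

variable {n : ℕ}

theorem integrable_norm_rpow_mul_inner {p : ℝ} (hp : 1 < p) {U : Set (Eucl n)}
    {G H : Eucl n → Eucl n} (hG : MemLp G (ENNReal.ofReal p) (volume.restrict U))
    (hH : MemLp H (ENNReal.ofReal p) (volume.restrict U)) :
    IntegrableOn (fun x => ‖G x‖ ^ (p - 2) * inner ℝ (G x) (H x)) U := by
  have hp0 : 0 < p := by linarith
  have hP0 : ENNReal.ofReal p ≠ 0 := by simpa using hp0
  have h1 := hG.integrable_norm_rpow hP0 ENNReal.ofReal_ne_top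
  have h2 := hH.integrable_norm_rpow hP0 ENNReal.ofReal_ne_top
  rw [ENNReal.toReal_ofReal hp0.le] at h1 h2
  refine (h1.add h2).mono' ?_ (Eventually.of_forall fun x => ?_)
  · exact ((hG.1.norm.aemeasurable.pow_const _).aestronglyMeasurable).mul (hG.1.inner hH.1)
  · rw [Real.norm_eq_abs]
    exact (norm_rpow_mul_inner_le _ _).trans
      (rpow_sub_one_mul_le_rpow_add_rpow hp (norm_nonneg _) (norm_nonneg _))

/-- The equation tested with the smooth step of `(u - g) / δ`. The lower bounds for the local and
nonlocal terms lose `r^(-p) |A| / δ` and `r^(-ps) |A| / δ`, up to constants, and dividing by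
`r^(1-p)` leaves `|A| / (r δ)`. The constant does not depend on `u`, `r`, `k` or `δ`, as the
iteration requires. -/
theorem exists_integral_norm_gradient_le (hn : 1 ≤ n) {p s Λ L κ : ℝ} (hp : 1 < p) (hs0 : 0 < s)
    (hs1 : s < 1) (hΛ : 0 ≤ Λ) (hκ : 0 ≤ κ) :
    ∃ C : ℝ, 0 < C ∧ ∀ (Ω : Set (Eucl n)) (K : Eucl n → Eucl n → ℝ) (u : Eucl n → ℝ)
      (x₀ : Eucl n) (r R k δ : ℝ), IsKernel p s Λ K → Measurable u → (∀ x, |u x| ≤ L) →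
      IsWeakSubsolution p K Ω u → Metric.closedBall x₀ R ⊆ Ω → 0 < r → r < R → r ≤ 1 →
      0 < δ → δ ≤ 1 → L ≤ κ + k →
      ∃ (H : Eucl n → Eucl n) (ψ : ℕ → Eucl n → ℝ),
        MemLp H (ENNReal.ofReal p) (volume.restrict (Metric.ball x₀ R)) ∧
        IsTestLimit p (Metric.ball x₀ R)
          (fun x => Real.smoothTransition ((u x - (barrier κ r x₀ x + k)) / δ)) H ψ ∧
        ∫ x in Metric.ball x₀ R, ‖H x‖ ≤
          C / (r * δ) * volume.real {x | 0 < u x - (barrier κ r x₀ x + k)} := by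
  obtain ⟨C, hC0, hC⟩ := exists_abs_deriv_smoothTransition_le
  set I := ∫ z, truncatedKernel n p s 1 z with hI
  have hI0 : 0 ≤ I := integral_nonneg fun z => truncatedKernel_nonneg one_pos z
  -- The constant is chosen before `u`; for `L < 0` the bound on `u` is contradictory.
  rcases lt_or_ge L 0 with hL | hL
  · refine ⟨1, one_pos, fun Ω K u x₀ r R k δ _ _ huL => ?_⟩
    exact absurd ((abs_nonneg _).trans (huL 0)) (not_le.2 hL)
  set c₁ := 2 * κ / 2 + 1 / 2 + 2 ^ (p - 1) * (2 * κ) ^ p with hc₁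
  set c₂ := C * (3 * κ) ^ p + (2 * L) ^ (p - 1) with hc₂
  have hc₁0 : 0 < c₁ := by positivity
  have hc₂0 : 0 ≤ c₂ := by positivity
  refine ⟨2 * (C * c₁ + 2 * (c₂ * Λ * I)), by positivity, ?_⟩
  intro Ω K u x₀ r R k δ hK hum huL hu hRΩ hr hrR hr1 hδ hδ1 hLk
  have hR : 0 < R := hr.trans hrR
  set U := Metric.ball x₀ R with hU
  have hUm : MeasurableSet U := measurableSet_ball
  have hUfin : volume U < ⊤ := measure_ball_lt_top
  have hfinU : IsFiniteMeasure (volume.restrict U) := ⟨by simpa using hUfin⟩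
  have hUΩ : CompactlyContained U Ω := by
    have := closure_ball x₀ hR.ne'
    rw [← hU] at this
    unfold CompactlyContained
    rw [this]
    exact ⟨isCompact_closedBall x₀ R, hRΩ⟩
  obtain ⟨-, G, hG, hGp⟩ := hu.memW1pLoc U Metric.isOpen_ball hUΩ
  set g : Eucl n → ℝ := fun x => barrier κ r x₀ x + k with hg
  have hgc : ContDiff ℝ ∞ g := contDiff_barrier_add κ r k x₀
  set T : ℝ → ℝ := fun t => Real.smoothTransition (t / δ) with hT
  have hTc : ContDiff ℝ ∞ T :=
    (Real.smoothTransition.contDiff (n := ⊤)).comp (contDiff_id.div_const δ)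
  have hdT : ∀ t, deriv T t = deriv Real.smoothTransition (t / δ) / δ :=
    deriv_smoothTransition_div δ
  have hT0 : ∀ t ≤ 0, T t = 0 := fun t ht =>
    Real.smoothTransition.zero_of_nonpos (div_nonpos_of_nonpos_of_nonneg ht hδ.le)
  have hT0' : ∀ t ≤ 0, deriv T t = 0 := fun t ht => by
    rw [hdT, deriv_smoothTransition_of_nonpos (div_nonpos_of_nonpos_of_nonneg ht hδ.le), zero_div]
  have hTC : ∀ t, |deriv T t| ≤ C / δ := fun t => by
    rw [hdT, abs_div, abs_of_pos hδ]
    exact div_le_div_of_nonneg_right (hC _) hδ.le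
  have hTm : Monotone T := fun a b hab =>
    Real.smoothTransition.monotone (div_le_div_of_nonneg_right hab hδ.le)
  have hTd0 : ∀ t, 0 ≤ deriv T t := fun t => hTm.deriv_nonneg
  have hTl : ∀ a b, |T a - T b| ≤ C / δ * |a - b| := fun a b =>
    Convex.norm_image_sub_le_of_norm_deriv_le (s := Set.univ)
      (fun x _ => hTc.differentiable (by simp) x) (fun x _ => hTC x) convex_univ trivial trivial
  have hgL : ∀ x, x ∉ Metric.ball x₀ r → L ≤ g x := fun x hx =>
    hLk.trans (add_le_add_left (le_barrier_of_notMem_ball hκ hr hx) k)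
  set A := {x | 0 < u x - g x} with hA
  have hAm : MeasurableSet A :=
    measurableSet_lt measurable_const (hum.sub hgc.continuous.measurable)
  have hAr : A ⊆ Metric.ball x₀ r := fun x hx => by
    by_contra hxr
    have h1 := hgL x hxr
    have h2 := (abs_le.1 (huL x)).2
    have h3 : 0 < u x - g x := hx
    linarith
  have hAf : volume A ≠ ⊤ := ((measure_mono hAr).trans_lt measure_ball_lt_top).ne
  obtain ⟨hHp, ψ, hψ⟩ := exists_isTestLimit_comp_sub hp hrR hum huL hG hGp hgc hgL hTc hT0 hT0' hTC
  set H : Eucl n → Eucl n := fun x => deriv T (u x - g x) • (G x - gradient g x) with hH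
  set φ : Eucl n → ℝ := fun x => T (u x - g x) with hφ
  refine ⟨H, ψ, hHp, hψ, ?_⟩
  have hφ0 : ∀ x, x ∉ U → φ x = 0 := fun x hx => by
    refine hT0 _ (sub_nonpos.2 (((le_abs_self _).trans (huL x)).trans (hgL x fun h => hx ?_)))
    exact Metric.ball_subset_ball hrR.le h
  have hφm : Measurable φ :=
    hTc.continuous.measurable.comp (hum.sub hgc.continuous.measurable)
  have hT1 : ∀ t, T t ≤ 1 := fun t => Real.smoothTransition.le_one _
  have hTn : ∀ t, 0 ≤ T t := fun t => Real.smoothTransition.nonneg _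
  have hφL : MemLp φ (ENNReal.ofReal p) (volume.restrict U) :=
    MemLp.of_bound hφm.aestronglyMeasurable 1 (Eventually.of_forall fun x => by
      rw [Real.norm_of_nonneg (hTn _)]; exact hT1 _)
  have hsub := hu.le_zero U Metric.isOpen_ball hUΩ φ
    (hψ.memW1pZero hp hUfin hφ0 hφL hHp) (fun x => hTn _) G H hG
    (hψ.hasWeakGradient hp hUfin hφL hHp)
  -- the nonlocal term
  have hJ := (integrable_truncatedKernel hn hp hs0 hs1 hr).const_mul
    ((C / δ * (3 * κ) ^ p + (2 * L) ^ (p - 1)) * Λ)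
  have hnl := neg_le_integral_of_neg_indicator_le hAm hAf hJ
    (fun z => mul_nonneg (by positivity) (truncatedKernel_nonneg hr z))
    (fun z => by rw [truncatedKernel_neg])
    (f := fun z => |u z.1 - u z.2| ^ (p - 2) * (u z.1 - u z.2) * (φ z.1 - φ z.2) * K z.1 z.2)
    (neg_indicator_le_nonlocal_integrand hp hr (by positivity) (by positivity) hΛ hK huL
      (fun x y hy hxy => by
        rw [hg, add_sub_add_right_eq_sub]
        exact abs_barrier_sub_le hκ hr (hAr hy) hxy) hTm hT0 hT1 hTl)
  rw [integral_const_mul, integral_truncatedKernel hr] at hnl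
  -- the local term
  have hHi : IntegrableOn H U := hHp.integrable
    (by simpa using ENNReal.ofReal_le_ofReal hp.le)
  have hloc : 1 / 2 * r ^ (1 - p) * ∫ x in U, ‖H x‖ ≤
      (∫ x in U, ‖G x‖ ^ (p - 2) * inner ℝ (G x) (H x)) +
        C / δ * (c₁ * r ^ (-p)) * volume.real A := by
    have hi1 : IntegrableOn (fun x => 1 / 2 * r ^ (1 - p) * ‖H x‖) U := hHi.norm.const_mul _
    have hi2 : IntegrableOn (A.indicator fun _ => C / δ * (c₁ * r ^ (-p))) U :=
      ((integrable_indicator_iff hAm).2 (integrableOn_const hAf)).integrableOn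
    have hi3 := integrable_norm_rpow_mul_inner hp hGp hHp
    have h1 : ∫ x in U, (1 / 2 * r ^ (1 - p) * ‖H x‖ -
        A.indicator (fun _ => C / δ * (c₁ * r ^ (-p))) x) ≤
        ∫ x in U, ‖G x‖ ^ (p - 2) * inner ℝ (G x) (H x) := by
      refine integral_mono (hi1.sub hi2) hi3 fun x => ?_
      by_cases hx : x ∈ A
      · simp only [Set.indicator_of_mem hx]
        refine le_trans ?_ (le_norm_rpow_mul_inner_smul_sub hp hr (D := 2 * κ) (by positivity)
          (hTd0 (u x - g x)) (norm_gradient_barrier_add_le hκ hr k (hAr hx)))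
        refine sub_le_sub_left ?_ _
        refine mul_le_mul_of_nonneg_right ((le_abs_self _).trans (hTC _)) ?_
        exact mul_nonneg hc₁0.le (Real.rpow_nonneg hr.le _)
      · have hH0 : H x = 0 := by
          simp only [hH]
          rw [hT0' _ (not_lt.1 hx), zero_smul]
        simp [hH0, Set.indicator_of_notMem hx]
    rw [integral_sub hi1 hi2, integral_const_mul, integral_indicator hAm,
      setIntegral_const, smul_eq_mul] at h1
    have h2 : (volume.restrict U).real A ≤ volume.real A := by
      refine ENNReal.toReal_mono hAf (Measure.restrict_le_self A)
    have h3 : 0 ≤ C / δ * (c₁ * r ^ (-p)) := by positivity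
    have := mul_le_mul_of_nonneg_right h2 h3
    linarith
  -- combine
  set a := volume.real A with ha
  have ha0 : 0 ≤ a := measureReal_nonneg
  have hrp : 0 < r ^ (-p) := Real.rpow_pos_of_pos hr _
  -- For `r ≤ 1` the nonlocal scaling is dominated by the local one. Likewise, `δ ≤ 1` below absorbs
  -- the long-range constant into `c₂ / δ`.
  have hrps : r ^ (-(p * s)) ≤ r ^ (-p) :=
    Real.rpow_le_rpow_of_exponent_ge hr hr1 (by nlinarith)
  have hcc : C / δ * (3 * κ) ^ p + (2 * L) ^ (p - 1) ≤ c₂ / δ := by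
    rw [hc₂, add_div, div_mul_eq_mul_div]
    gcongr
    exact le_div_self (by positivity) hδ hδ1
  have hnl2 : 2 * a * ((C / δ * (3 * κ) ^ p + (2 * L) ^ (p - 1)) * Λ * (r ^ (-(p * s)) * I)) ≤
      2 * a * (c₂ / δ * Λ * (r ^ (-p) * I)) := by gcongr
  have hfin : 1 / 2 * r ^ (1 - p) * ∫ x in U, ‖H x‖ ≤
      r ^ (-p) * ((C * c₁ + 2 * (c₂ * Λ * I)) / δ * a) := by
    have e : r ^ (-p) * ((C * c₁ + 2 * (c₂ * Λ * I)) / δ * a) =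
      C / δ * (c₁ * r ^ (-p)) * a + 2 * a * (c₂ / δ * Λ * (r ^ (-p) * I)) := by ring
    rw [e]
    linarith
  have e : r ^ (1 - p) = r ^ (-p) * r := by
    rw [sub_eq_add_neg, Real.rpow_add hr, Real.rpow_one, mul_comm]
  rw [e, show 1 / 2 * (r ^ (-p) * r) * ∫ x in U, ‖H x‖ = r ^ (-p) * (r / 2 * ∫ x in U, ‖H x‖) by
    ring] at hfin
  have hfin2 := le_of_mul_le_mul_left hfin hrp
  rw [show 2 * (C * c₁ + 2 * (c₂ * Λ * I)) / (r * δ) * a =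
    2 / r * ((C * c₁ + 2 * (c₂ * Λ * I)) / δ * a) by field_simp]
  calc ∫ x in U, ‖H x‖ = 2 / r * (r / 2 * ∫ x in U, ‖H x‖) := by field_simp
    _ ≤ _ := by gcongr

/-- The superlevel sets of a subsolution relative to the barrier decay superlinearly. -/
theorem exists_measureReal_superlevel_le (hn : 1 ≤ n) {p s Λ L κ : ℝ} (hp : 1 < p) (hs0 : 0 < s)
    (hs1 : s < 1) (hΛ : 0 ≤ Λ) (hκ : 0 ≤ κ) :
    ∃ C : ℝ, 0 < C ∧ ∀ (Ω : Set (Eucl n)) (K : Eucl n → Eucl n → ℝ) (u : Eucl n → ℝ)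
      (x₀ : Eucl n) (r R k δ : ℝ), IsKernel p s Λ K → Measurable u → (∀ x, |u x| ≤ L) →
      IsWeakSubsolution p K Ω u → Metric.closedBall x₀ R ⊆ Ω → 0 < r → r < R → r ≤ 1 →
      0 < δ → δ ≤ 1 → L ≤ κ + k →
      volume.real {x | k + δ < u x - barrier κ r x₀ x} ≤
        C / (r * δ) * volume.real {x | k < u x - barrier κ r x₀ x} ^ (1 + 1 / (n : ℝ)) := by
  obtain ⟨C₁, hC₁, h₁⟩ := exists_integral_norm_gradient_le (L := L) hn hp hs0 hs1 hΛ hκ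
  obtain ⟨C₂, h₂⟩ := exists_lintegral_le_measure_rpow_mul_lintegral_gradient hn
  -- The Sobolev constant may be zero; adding 1 makes the product strictly positive, as is needed to
  -- divide by it when choosing `ν`.
  refine ⟨(C₂ + 1) * C₁, by positivity, ?_⟩
  intro Ω K u x₀ r R k δ hK hum huL hu hRΩ hr hrR hr1 hδ hδ1 hLk
  obtain ⟨H, ψ, hHp, hψ, hHi⟩ := h₁ Ω K u x₀ r R k δ hK hum huL hu hRΩ hr hrR hr1 hδ hδ1 hLk
  set U := Metric.ball x₀ R with hU
  have hUm : MeasurableSet U := measurableSet_ball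
  have hUfin : volume U < ⊤ := measure_ball_lt_top
  have hfinU : IsFiniteMeasure (volume.restrict U) := ⟨by simpa using hUfin⟩
  have hgm : Measurable fun x => barrier κ r x₀ x := by
    have := (contDiff_barrier_add κ r 0 x₀).continuous.measurable
    simpa using this
  set φ : Eucl n → ℝ := fun x =>
    Real.smoothTransition ((u x - (barrier κ r x₀ x + k)) / δ) with hφ
  have hφm : Measurable φ := Real.smoothTransition.continuous.measurable.comp
    ((hum.sub (hgm.add_const k)).div_const δ)
  set S := {x | k < u x - barrier κ r x₀ x} with hS
  have hSe : {x | 0 < u x - (barrier κ r x₀ x + k)} = S := by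
    ext x
    simp only [hS, Set.mem_ofPred_eq]
    constructor <;> intro h <;> linarith
  rw [hSe] at hHi
  have hSr : S ⊆ Metric.ball x₀ r := fun x hx => by
    by_contra hxr
    have h1 := le_barrier_of_notMem_ball hκ hr hxr
    have h2 := (abs_le.1 (huL x)).2
    have h3 : k < u x - barrier κ r x₀ x := hx
    linarith
  have hSf : volume S ≠ ⊤ := ((measure_mono hSr).trans_lt measure_ball_lt_top).ne
  have key := h₂ p U S φ H ψ hp hUfin hψ hφm.aestronglyMeasurable hHp.1 (fun x hx => by
    have : ¬ k < u x - barrier κ r x₀ x := hx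
    exact Real.smoothTransition.zero_of_nonpos
      (div_nonpos_of_nonpos_of_nonneg (by linarith) hδ.le))
  set B := {x | k + δ < u x - barrier κ r x₀ x} with hB
  have hBm : MeasurableSet B := measurableSet_lt measurable_const (hum.sub hgm)
  have hBS : B ⊆ S := fun x hx => by
    have : k + δ < u x - barrier κ r x₀ x := hx
    show k < u x - barrier κ r x₀ x
    linarith
  have hBU : B ⊆ U := hBS.trans (hSr.trans (Metric.ball_subset_ball hrR.le))
  -- On `B` the step function has already reached 1.
  have hlow : volume B ≤ ∫⁻ x in U, ‖φ x‖ₑ := by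
    calc volume B = ∫⁻ x in B, 1 := by simp
      _ = ∫⁻ x in B, ‖φ x‖ₑ := by
          refine setLIntegral_congr_fun hBm fun x hx => ?_
          have hx' : k + δ < u x - barrier κ r x₀ x := hx
          have : φ x = 1 := Real.smoothTransition.one_of_one_le (by
            rw [le_div_iff₀ hδ]; linarith)
          simp [this]
      _ ≤ ∫⁻ x in U, ‖φ x‖ₑ := lintegral_mono_set hBU
  have hHint : IntegrableOn H U := hHp.integrable
    (by simpa using ENNReal.ofReal_le_ofReal hp.le)
  have hHfin : ∫⁻ x in U, ‖H x‖ₑ ≠ ⊤ := hHint.2.ne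
  have hreal := ENNReal.toReal_mono (ENNReal.mul_ne_top (ENNReal.mul_ne_top ENNReal.coe_ne_top
    (ENNReal.rpow_ne_top_of_nonneg (by positivity) hSf)) hHfin) (hlow.trans key)
  rw [ENNReal.toReal_mul, ENNReal.toReal_mul, ← ENNReal.toReal_rpow, ENNReal.coe_toReal,
    ← integral_norm_eq_lintegral_enorm hHp.1] at hreal
  change volume.real B ≤ C₂ * volume.real S ^ (1 / (n : ℝ)) * ∫ x in U, ‖H x‖ at hreal
  set a := volume.real S with ha
  have ha0 : 0 ≤ a := measureReal_nonneg
  calc volume.real B ≤ C₂ * a ^ (1 / (n : ℝ)) * ∫ x in U, ‖H x‖ := hreal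
    _ ≤ C₂ * a ^ (1 / (n : ℝ)) * (C₁ / (r * δ) * a) := by gcongr
    _ = C₂ * C₁ / (r * δ) * (a * a ^ (1 / (n : ℝ))) := by ring
    _ ≤ (C₂ + 1) * C₁ / (r * δ) * (a * a ^ (1 / (n : ℝ))) := by gcongr; linarith
    _ = _ := by
        rw [Real.rpow_add_of_nonneg ha0 zero_le_one (by positivity), Real.rpow_one]

/-- Fast geometric convergence: if `a j` has decayed by `2^(-n j)`, the extra power `1/n`
contributes `2^(-j)`, which cancels the growth `2^j` of the recursion. The smallness of `a 0` then
pays for one more factor `2^(-n)`. -/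
theorem le_mul_pow_of_le_two_pow_mul_rpow (hn : 1 ≤ n) {a : ℕ → ℝ} {c : ℝ} (hc : 0 ≤ c)
    (ha : ∀ j, 0 ≤ a j) (h : ∀ j, a (j + 1) ≤ c * 2 ^ (j + 1) * a j ^ (1 + 1 / (n : ℝ)))
    (h0 : 2 * c * a 0 ^ (1 / (n : ℝ)) ≤ (1 / 2) ^ n) (j : ℕ) :
    a j ≤ a 0 * ((1 / 2) ^ n) ^ j := by
  have hn0 : (n : ℝ) ≠ 0 := by positivity
  induction j with
  | zero => simp
  | succ j ih =>
    have h1 : a j ^ (1 / (n : ℝ)) ≤ a 0 ^ (1 / (n : ℝ)) * (1 / 2) ^ j := by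
      calc a j ^ (1 / (n : ℝ)) ≤ (a 0 * ((1 / 2) ^ n) ^ j) ^ (1 / (n : ℝ)) :=
            Real.rpow_le_rpow (ha j) ih (by positivity)
        _ = a 0 ^ (1 / (n : ℝ)) * (1 / 2) ^ j := by
            rw [Real.mul_rpow (ha 0) (by positivity), ← pow_mul, mul_comm n j, pow_mul,
              one_div (n : ℝ), Real.pow_rpow_inv_natCast (by positivity) (by omega)]
    have h2 : a j ^ (1 + 1 / (n : ℝ)) = a j * a j ^ (1 / (n : ℝ)) := by
      rw [Real.rpow_add_of_nonneg (ha j) zero_le_one (by positivity), Real.rpow_one]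
    calc a (j + 1) ≤ c * 2 ^ (j + 1) * (a j * a j ^ (1 / (n : ℝ))) := by rw [← h2]; exact h j
      _ ≤ c * 2 ^ (j + 1) * (a j * (a 0 ^ (1 / (n : ℝ)) * (1 / 2) ^ j)) := by
          have := ha j
          gcongr
      _ = (2 * c * a 0 ^ (1 / (n : ℝ))) * a j * (2 ^ j * (1 / 2) ^ j) := by ring
      _ = (2 * c * a 0 ^ (1 / (n : ℝ))) * a j := by
          rw [← mul_pow]; norm_num
      _ ≤ (1 / 2) ^ n * (a 0 * ((1 / 2) ^ n) ^ j) :=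
          mul_le_mul h0 ih (ha j) (by positivity)
      _ = _ := by ring

/-- De Giorgi's lemma: if `u` exceeds `l + M` only on a small portion of `B_r(x₀)`, then
`u ≤ l + 2 M` up to the barrier. -/
theorem exists_ae_le_of_measureReal_le (hn : 1 ≤ n) {p s Λ L κ l M : ℝ} (hp : 1 < p)
    (hs0 : 0 < s) (hs1 : s < 1) (hΛ : 0 ≤ Λ) (hκ : 0 ≤ κ) (hl : L ≤ κ + l) (hM : 0 < M)
    (hM1 : M ≤ 1) :
    ∃ ν : ℝ, 0 < ν ∧ ∀ (Ω : Set (Eucl n)) (K : Eucl n → Eucl n → ℝ) (u : Eucl n → ℝ)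
      (x₀ : Eucl n) (r R : ℝ), IsKernel p s Λ K → Measurable u → (∀ x, |u x| ≤ L) →
      IsWeakSubsolution p K Ω u → Metric.closedBall x₀ R ⊆ Ω → 0 < r → r < R → r ≤ 1 →
      volume.real {x | l + M < u x - barrier κ r x₀ x} ≤ (ν * r) ^ n →
      ∀ᵐ x, u x - barrier κ r x₀ x ≤ l + 2 * M := by
  obtain ⟨C, hC, h⟩ := exists_measureReal_superlevel_le (L := L) hn hp hs0 hs1 hΛ hκ
  -- Chosen so that `2 (C / (r M)) · (ν r) = 2^(-n)`, the starting condition of the iteration; the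
  -- radius cancels.
  refine ⟨M * (1 / 2) ^ n / (2 * C), by positivity, ?_⟩
  intro Ω K u x₀ r R hK hum huL hu hRΩ hr hrR hr1 hν
  -- Levels increasing from `l + M` towards `l + 2 M`, with gaps `M / 2^(j+1)`.
  set k : ℕ → ℝ := fun j => l + M * (2 - (1 / 2) ^ j) with hk
  set a : ℕ → ℝ := fun j => volume.real {x | k j < u x - barrier κ r x₀ x} with ha
  have hpow : ∀ j : ℕ, (1 / 2 : ℝ) ^ j ≤ 1 := fun j => pow_le_one₀ (by norm_num) (by norm_num)
  have hlk : ∀ j, l ≤ k j := fun j => by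
    have : 0 ≤ M * (2 - (1 / 2) ^ j) := mul_nonneg hM.le (by linarith [hpow j])
    simp only [hk]
    linarith
  have hstep : ∀ j, a (j + 1) ≤ C / (r * M) * 2 ^ (j + 1) * a j ^ (1 + 1 / (n : ℝ)) := by
    intro j
    have hδ : 0 < M * (1 / 2) ^ (j + 1) := by positivity
    have h1 := h Ω K u x₀ r R (k j) (M * (1 / 2) ^ (j + 1)) hK hum huL hu hRΩ hr hrR hr1 hδ
      (mul_le_one₀ hM1 (by positivity) (hpow _)) (hl.trans (add_le_add_right (hlk j) κ))
    have e : k j + M * (1 / 2) ^ (j + 1) = k (j + 1) := by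
      simp only [hk]; ring
    rw [e] at h1
    refine h1.trans_eq ?_
    congr 1
    rw [one_div, inv_pow]
    field_simp
  have ha0 : a 0 = volume.real {x | l + M < u x - barrier κ r x₀ x} := by
    simp only [ha, hk, pow_zero]
    norm_num
  rw [← ha0] at hν
  have hn0 : n ≠ 0 := by omega
  have hstart : 2 * (C / (r * M)) * a 0 ^ (1 / (n : ℝ)) ≤ (1 / 2) ^ n := by
    have h1 : a 0 ^ (1 / (n : ℝ)) ≤ M * (1 / 2) ^ n / (2 * C) * r := by
      refine (Real.rpow_le_rpow measureReal_nonneg hν (by positivity)).trans_eq ?_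
      rw [one_div (n : ℝ), Real.pow_rpow_inv_natCast (by positivity) hn0]
    calc 2 * (C / (r * M)) * a 0 ^ (1 / (n : ℝ)) ≤
        2 * (C / (r * M)) * (M * (1 / 2) ^ n / (2 * C) * r) := by gcongr
      _ = _ := by field_simp
  have hdecay := le_mul_pow_of_le_two_pow_mul_rpow (a := a) hn (by positivity)
    (fun j => measureReal_nonneg) hstep hstart
  have hSf : ∀ j, volume {x | k j < u x - barrier κ r x₀ x} ≠ ⊤ := fun j => by
    refine ((measure_mono fun x hx => ?_).trans_lt
      (measure_ball_lt_top (x := x₀) (r := r))).ne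
    by_contra hxr
    have h1 := le_barrier_of_notMem_ball hκ hr hxr
    have h2 := (abs_le.1 (huL x)).2
    have h3 : k j < u x - barrier κ r x₀ x := hx
    linarith [hlk j]
  have hle : ∀ j, volume.real {x | l + 2 * M < u x - barrier κ r x₀ x} ≤
      a 0 * ((1 / 2) ^ n) ^ j := fun j => by
    refine le_trans (measureReal_mono (fun x hx => ?_) (hSf j)) (hdecay j)
    have h3 : l + 2 * M < u x - barrier κ r x₀ x := hx
    show k j < u x - barrier κ r x₀ x
    have : 0 ≤ M * (1 / 2) ^ j := by positivity
    simp only [hk]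
    linarith
  have hlim : Tendsto (fun j => a 0 * ((1 / 2 : ℝ) ^ n) ^ j) atTop (𝓝 0) := by
    simpa using (tendsto_pow_atTop_nhds_zero_of_lt_one (by positivity)
      (pow_lt_one₀ (by norm_num) (by norm_num) hn0 : (1 / 2 : ℝ) ^ n < 1)).const_mul (a 0)
  have hzero := ge_of_tendsto' hlim hle
  have hfin2 : volume {x | l + 2 * M < u x - barrier κ r x₀ x} ≠ ⊤ := by
    refine ((measure_mono fun x hx => ?_).trans_lt (hSf 0).lt_top).ne
    have h3 : l + 2 * M < u x - barrier κ r x₀ x := hx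
    show k 0 < u x - barrier κ r x₀ x
    simp only [hk, pow_zero]
    linarith
  have hnull : volume {x | l + 2 * M < u x - barrier κ r x₀ x} = 0 :=
    (measureReal_eq_zero_iff hfin2).1 (le_antisymm hzero measureReal_nonneg)
  rw [ae_iff]
  simpa only [not_le] using hnull

end LevelSets

/-! ### Essential suprema over balls and Lebesgue points -/

section EssSup

variable {n : ℕ} {u : Eucl n → ℝ} {L : ℝ}

theorem ae_restrict_ball_neBot (x : Eucl n) {r : ℝ} (hr : 0 < r) :
    (ae (volume.restrict (Metric.ball x r))).NeBot :=
  ae_restrict_neBot.2 (Metric.measure_ball_pos volume x hr).ne'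

theorem ae_le_essSupBall (huL : ∀ᵐ x, |u x| ≤ L) (x : Eucl n) (r : ℝ) :
    ∀ᵐ y ∂(volume.restrict (Metric.ball x r)), u y ≤ essSupBall u x r :=
  ae_le_essSup ⟨L, eventually_map.2 ((ae_restrict_of_ae huL).mono fun _ h => (abs_le.1 h).2)⟩

/-- The real-valued `essSup` lives in a conditionally complete order, so the lower bound on `u` and
the positive measure of the ball are needed for coboundedness. -/
theorem essSupBall_le (huL : ∀ᵐ x, |u x| ≤ L) (x : Eucl n) {r c : ℝ} (hr : 0 < r)
    (h : ∀ᵐ y ∂(volume.restrict (Metric.ball x r)), u y ≤ c) : essSupBall u x r ≤ c := by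
  have := ae_restrict_ball_neBot x hr
  refine essSup_le_of_ae_le c h (IsBoundedUnder.isCoboundedUnder_le ?_)
  exact ⟨-L, eventually_map.2 ((ae_restrict_of_ae huL).mono fun _ h => (abs_le.1 h).1)⟩

theorem essSupBall_le_essSupBall (huL : ∀ᵐ x, |u x| ≤ L) {x y : Eucl n} {r t : ℝ} (ht : 0 < t)
    (h : Metric.ball y t ⊆ Metric.ball x r) : essSupBall u y t ≤ essSupBall u x r :=
  essSupBall_le huL y ht (ae_restrict_of_ae_restrict_of_subset h (ae_le_essSupBall huL x r))

theorem neg_le_essSupBall (huL : ∀ᵐ x, |u x| ≤ L) (x : Eucl n) {r : ℝ} (hr : 0 < r) :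
    -L ≤ essSupBall u x r := by
  have := ae_restrict_ball_neBot x hr
  obtain ⟨y, h1, h2⟩ := ((ae_le_essSupBall huL x r).and (ae_restrict_of_ae huL)).exists
  exact (abs_le.1 h2).1.trans h1

theorem tendsto_essSupBall (huL : ∀ᵐ x, |u x| ≤ L) (x : Eucl n) :
    Tendsto (essSupBall u x) (𝓝[>] 0) (𝓝 (sInf (essSupBall u x '' Set.Ioi 0))) := by
  have hbdd : BddBelow (essSupBall u x '' Set.Ioi 0) := by
    refine ⟨-L, ?_⟩
    rintro _ ⟨r, hr, rfl⟩
    exact neg_le_essSupBall huL x hr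
  rw [tendsto_order]
  refine ⟨fun c hc => ?_, fun c hc => ?_⟩
  · filter_upwards [self_mem_nhdsWithin] with r hr
    exact hc.trans_le (csInf_le hbdd ⟨r, hr, rfl⟩)
  · obtain ⟨_, ⟨r, hr, rfl⟩, hrc⟩ :=
      exists_lt_of_csInf_lt (Set.Nonempty.image _ ⟨1, Set.mem_Ioi.2 one_pos⟩) hc
    filter_upwards [Ioo_mem_nhdsGT (Set.mem_Ioi.1 hr)] with t ht
    exact (essSupBall_le_essSupBall huL ht.1 (Metric.ball_subset_ball ht.2.le)).trans_lt hrc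

theorem tendsto_essSupBall_uscReg (huL : ∀ᵐ x, |u x| ≤ L) (x : Eucl n) :
    Tendsto (essSupBall u x) (𝓝[>] 0) (𝓝 (uscReg u x)) := by
  have h := tendsto_essSupBall huL x
  rwa [uscReg, h.limUnder_eq]

theorem uscReg_le_essSupBall (huL : ∀ᵐ x, |u x| ≤ L) (x : Eucl n) {r : ℝ} (hr : 0 < r) :
    uscReg u x ≤ essSupBall u x r := by
  refine le_of_tendsto (tendsto_essSupBall_uscReg huL x) ?_
  filter_upwards [Ioo_mem_nhdsGT hr] with t ht
  exact essSupBall_le_essSupBall huL ht.1 (Metric.ball_subset_ball ht.2.le)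

/-- Every point of `B_r(x)` has a ball inside `B_r(x)`, so one radius with essential supremum below
`c` bounds the regularization on the whole ball. -/
theorem upperSemicontinuous_uscReg (huL : ∀ᵐ x, |u x| ≤ L) :
    UpperSemicontinuous (uscReg u) := by
  intro x c hc
  obtain ⟨r, hrc, hr⟩ := (((tendsto_order.1 (tendsto_essSupBall_uscReg huL x)).2 c hc).and
    self_mem_nhdsWithin).exists
  filter_upwards [Metric.ball_mem_nhds x hr] with y hy
  obtain ⟨t, ht, hty⟩ := Metric.isOpen_iff.1 Metric.isOpen_ball y hy
  exact ((uscReg_le_essSupBall huL y ht).trans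
    (essSupBall_le_essSupBall huL ht hty)).trans_lt hrc

theorem uscReg_congr {v : Eucl n → ℝ} (h : u =ᵐ[volume] v) : uscReg u = uscReg v := by
  have : essSupBall u = essSupBall v := by
    ext x r
    exact essSup_congr_ae (ae_restrict_of_ae h)
  ext x
  rw [uscReg, uscReg, this]

theorem integrableOn_ball_abs_sub (hum : AEStronglyMeasurable u volume)
    (huL : ∀ᵐ x, |u x| ≤ L) (l : ℝ) (x : Eucl n) (r : ℝ) :
    IntegrableOn (fun y => |l - u y|) (Metric.ball x r) := by
  have : IsFiniteMeasure (volume.restrict (Metric.ball x r)) :=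
    ⟨by simpa using measure_ball_lt_top⟩
  have h : IntegrableOn u (Metric.ball x r) :=
    Integrable.of_bound hum.restrict L (ae_restrict_of_ae huL)
  exact ((integrable_const l).sub h).abs

/-- The value at a Lebesgue point does not exceed the upper semicontinuous regularization. -/
theorem le_uscReg_of_tendsto_average (hum : AEStronglyMeasurable u volume)
    (huL : ∀ᵐ x, |u x| ≤ L) {x : Eucl n} {l : ℝ}
    (hl : Tendsto (fun r : ℝ => ⨍ y in Metric.ball x r, |l - u y|) (𝓝[>] 0) (𝓝 0)) :
    l ≤ uscReg u x := by
  have h : Tendsto (fun r => l - essSupBall u x r) (𝓝[>] 0) (𝓝 (l - uscReg u x)) :=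
    (tendsto_essSupBall_uscReg huL x).const_sub l
  refine sub_nonpos.1 (le_of_tendsto_of_tendsto h hl ?_)
  filter_upwards [self_mem_nhdsWithin] with r hr
  have hm : volume (Metric.ball x r) ≠ 0 := (Metric.measure_ball_pos volume x hr).ne'
  have hmt : volume (Metric.ball x r) ≠ ⊤ := measure_ball_lt_top.ne
  have hpos : 0 < volume.real (Metric.ball x r) := ENNReal.toReal_pos hm hmt
  rw [setAverage_eq, smul_eq_mul, le_inv_mul_iff₀ hpos, ← smul_eq_mul, ← setIntegral_const]
  refine integral_mono_ae (integrableOn_const hmt) (integrableOn_ball_abs_sub hum huL l x r) ?_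
  filter_upwards [ae_le_essSupBall huL x r] with y hy
  exact (sub_le_sub_left hy l).trans (le_abs_self _)

/-- Almost every point is a Lebesgue point. -/
theorem ae_tendsto_average_ball (hn : 1 ≤ n) (hu : LocallyIntegrable u volume) :
    ∀ᵐ x, Tendsto (fun r : ℝ => ⨍ y in Metric.ball x r, |u x - u y|) (𝓝[>] 0) (𝓝 0) := by
  have : Nonempty (Fin n) := ⟨⟨0, hn⟩⟩
  filter_upwards [(Besicovitch.vitaliFamily volume).ae_tendsto_average_norm_sub hu] with x hx
  refine (hx.comp (Besicovitch.tendsto_filterAt volume x)).congr fun r => ?_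
  -- The Besicovitch differentiation theorem uses closed balls; spheres are null for every radius
  -- because `n ≥ 1`.
  have e : (Metric.closedBall x r : Set (Eucl n)) =ᵐ[volume] Metric.ball x r := by
    rw [← Metric.ball_union_sphere]
    exact union_ae_eq_left_of_ae_eq_empty (ae_eq_empty.2 (Measure.addHaar_sphere volume x r))
  simp only [Function.comp_apply, Real.norm_eq_abs]
  rw [setAverage_congr e]
  simp_rw [abs_sub_comm]

end EssSup

/-! ### Passing to a measurable bounded representative -/

section Congr

variable {n : ℕ}

theorem HasWeakGradient.congr {U : Set (Eucl n)} {u v : Eucl n → ℝ} {G : Eucl n → Eucl n}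
    (h : HasWeakGradient U u G) (huv : u =ᵐ[volume] v) : HasWeakGradient U v G where
  locallyIntegrableOn := h.locallyIntegrableOn.congr (ae_restrict_of_ae huv)
  locallyIntegrableOn_grad := h.locallyIntegrableOn_grad
  integral_eq φ hφ w := by
    rw [← h.integral_eq φ hφ w]
    refine integral_congr_ae ?_
    filter_upwards [ae_restrict_of_ae huv] with x hx
    rw [hx]

/-- Allows `u` to be replaced by a Borel function bounded everywhere, which the level set estimates
assume. -/
theorem IsWeakSubsolution.congr {p : ℝ} {K : Eucl n → Eucl n → ℝ} {Ω : Set (Eucl n)}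
    {u v : Eucl n → ℝ} (h : IsWeakSubsolution p K Ω u) (huv : u =ᵐ[volume] v) :
    IsWeakSubsolution p K Ω v where
  memLp_top := h.memLp_top.ae_eq huv
  memW1pLoc U hU hUΩ := by
    obtain ⟨h1, G, hG, hGp⟩ := h.memW1pLoc U hU hUΩ
    exact ⟨h1.ae_eq (ae_restrict_of_ae huv), G, hG.congr huv, hGp⟩
  le_zero U hU hUΩ φ hφ hφ0 G H hG hH := by
    refine le_trans (le_of_eq ?_) (h.le_zero U hU hUΩ φ hφ hφ0 G H (hG.congr huv.symm) hH)
    congr 1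
    refine integral_congr_ae ?_
    have h1 : ∀ᵐ z : Eucl n × Eucl n ∂(volume.prod volume), u z.1 = v z.1 :=
      Measure.quasiMeasurePreserving_fst.ae huv
    have h2 : ∀ᵐ z : Eucl n × Eucl n ∂(volume.prod volume), u z.2 = v z.2 :=
      Measure.quasiMeasurePreserving_snd.ae huv
    filter_upwards [h1, h2] with z hz1 hz2
    rw [hz1, hz2]

theorem exists_measurable_bounded_ae_eq {u : Eucl n → ℝ} (hu : MemLp u ⊤ volume) :
    ∃ (v : Eucl n → ℝ) (L : ℝ), Measurable v ∧ (∀ x, |v x| ≤ L) ∧ u =ᵐ[volume] v := by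
  set L := (eLpNormEssSup u volume).toReal with hL
  have hL0 : 0 ≤ L := ENNReal.toReal_nonneg
  have hfin : eLpNormEssSup u volume ≠ ⊤ := by
    have := hu.2.ne
    rwa [eLpNorm_exponent_top] at this
  have hm := hu.1.stronglyMeasurable_mk.measurable
  refine ⟨fun x => max (-L) (min L (hu.1.mk u x)), L,
    measurable_const.max (measurable_const.min hm), fun x => abs_le.2 ⟨le_max_left _ _, ?_⟩, ?_⟩
  · exact max_le (by linarith) (min_le_left _ _)
  · filter_upwards [hu.1.ae_eq_mk, ae_le_eLpNormEssSup (f := u) (μ := volume)] with x hx hxL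
    have h1 : |u x| ≤ L := by
      have := ENNReal.toReal_mono hfin hxL
      simpa using this
    rw [← hx, min_eq_right (abs_le.1 h1).2, max_eq_right (abs_le.1 h1).1]

end Congr

/-! ### The upper bound at Lebesgue points -/

section LebesguePoints

variable {n : ℕ}

/-- At a Lebesgue point, the upper semicontinuous regularization of a subsolution does not exceed
the Lebesgue value. -/
theorem uscReg_le_of_tendsto_average (hn : 1 ≤ n) {p s Λ L l : ℝ} (hp : 1 < p) (hs0 : 0 < s)
    (hs1 : s < 1) (hΛ : 0 ≤ Λ) {Ω : Set (Eucl n)} (hΩ : IsOpen Ω) {K : Eucl n → Eucl n → ℝ}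
    (hK : IsKernel p s Λ K) {u : Eucl n → ℝ} (hum : Measurable u) (huL : ∀ x, |u x| ≤ L)
    (hu : IsWeakSubsolution p K Ω u) {x₀ : Eucl n} (hx₀ : x₀ ∈ Ω)
    (hl : Tendsto (fun r : ℝ => ⨍ y in Metric.ball x₀ r, |l - u y|) (𝓝[>] 0) (𝓝 0)) :
    uscReg u x₀ ≤ l := by
  have hn0 : Nonempty (Fin n) := ⟨⟨0, hn⟩⟩
  have hL : 0 ≤ L := (abs_nonneg _).trans (huL x₀)
  have huL' : ∀ᵐ x, |u x| ≤ L := Eventually.of_forall huL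
  -- Large enough that the barrier at level `l` dominates `L` outside `B_r(x₀)`, and independent of
  -- `r` and `M`.
  set κ := L + |l| with hκ
  have hκ0 : 0 ≤ κ := by positivity
  have hκl : L ≤ κ + l := by linarith [neg_abs_le l]
  suffices h : ∀ M : ℝ, 0 < M → M ≤ 1 → uscReg u x₀ ≤ l + 3 * M by
    refine le_of_forall_pos_le_add fun ε hε => ?_
    refine (h (min (ε / 3) 1) (by positivity) (min_le_right _ _)).trans ?_
    linarith [min_le_left (ε / 3) 1]
  intro M hM hM1
  obtain ⟨ν, hν, hdg⟩ := exists_ae_le_of_measureReal_le (L := L) hn hp hs0 hs1 hΛ hκ0 hκl hM hM1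
  obtain ⟨R, hR, hRΩ⟩ := Metric.nhds_basis_closedBall.mem_iff.1 (hΩ.mem_nhds hx₀)
  set θ := volume.real (Metric.ball (0 : Eucl n) 1) with hθ
  have hθ0 : 0 < θ :=
    ENNReal.toReal_pos (Metric.measure_ball_pos volume _ one_pos).ne' measure_ball_lt_top.ne
  have hev : ∀ᶠ r in 𝓝[>] (0 : ℝ), ⨍ y in Metric.ball x₀ r, |l - u y| < M * ν ^ n / θ :=
    (tendsto_order.1 hl).2 _ (by positivity)
  obtain ⟨r, hravg, hr⟩ := (hev.and (Ioo_mem_nhdsGT (lt_min hR one_pos))).exists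
  have hr0 : 0 < r := hr.1
  have hrR : r < R := hr.2.trans_le (min_le_left _ _)
  have hr1 : r ≤ 1 := (hr.2.trans_le (min_le_right _ _)).le
  have hball : volume.real (Metric.ball x₀ r) = r ^ n * θ := by
    rw [measureReal_def, Measure.addHaar_ball volume x₀ hr0.le, ENNReal.toReal_mul,
      finrank_euclideanSpace, Fintype.card_fin, ENNReal.toReal_ofReal (by positivity)]
    rfl
  -- Chebyshev: the barrier is nonnegative and the set lies in `B_r(x₀)`, so on it `|l - u| ≥ M`.
  -- The threshold `M ν^n / θ` for the average was chosen to give exactly `(ν r)^n`.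
  have hsmall : volume.real {x | l + M < u x - barrier κ r x₀ x} ≤ (ν * r) ^ n := by
    have h1 := mul_meas_ge_le_integral_of_nonneg
      (Eventually.of_forall fun y => abs_nonneg (l - u y))
      (integrableOn_ball_abs_sub hum.aestronglyMeasurable huL' l x₀ r) M
    have h2 : volume.real {x | l + M < u x - barrier κ r x₀ x} ≤
        (volume.restrict (Metric.ball x₀ r)).real {y | M ≤ |l - u y|} := by
      have hms : MeasurableSet {y | M ≤ |l - u y|} :=
        measurableSet_le measurable_const (hum.const_sub l).abs
      rw [measureReal_restrict_apply hms]
      refine measureReal_mono (fun x hx => ?_)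
        ((measure_mono Set.inter_subset_right).trans_lt measure_ball_lt_top).ne
      have hx' : l + M < u x - barrier κ r x₀ x := hx
      have hb0 : 0 ≤ barrier κ r x₀ x := by unfold barrier; positivity
      refine ⟨?_, ?_⟩
      · show M ≤ |l - u x|
        rw [abs_sub_comm]
        exact le_trans (by linarith) (le_abs_self _)
      · by_contra hxr
        have h3 := le_barrier_of_notMem_ball hκ0 hr0 hxr
        have h4 := (abs_le.1 (huL x)).2
        linarith
    have hb : 0 < volume.real (Metric.ball x₀ r) := by rw [hball]; positivity
    rw [setAverage_eq, smul_eq_mul, inv_mul_lt_iff₀ hb, hball] at hravg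
    have h3 : M * volume.real {x | l + M < u x - barrier κ r x₀ x} ≤
        r ^ n * θ * (M * ν ^ n / θ) :=
      ((mul_le_mul_of_nonneg_left h2 hM.le).trans h1).trans hravg.le
    have h4 : r ^ n * θ * (M * ν ^ n / θ) = M * (ν * r) ^ n := by
      rw [mul_pow]
      field_simp
    rw [h4] at h3
    exact le_of_mul_le_mul_left h3 hM
  have hae := hdg Ω K u x₀ r R hK hum huL hu hRΩ hr0 hrR hr1 hsmall
  -- With this `t ≤ 1`, the barrier on `B_{rt}(x₀)` is at most `κ t² ≤ κ t ≤ M`; the `+ 1` covers `κ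
  -- = 0`.
  set t := M / (κ + 1) with ht
  have ht0 : 0 < t := by positivity
  have ht1 : t ≤ 1 := by
    rw [ht, div_le_one (by positivity)]
    linarith
  have hκt : (κ + 1) * t = M := by rw [ht]; field_simp
  have htr : 0 < r * t := by positivity
  refine (uscReg_le_essSupBall huL' x₀ htr).trans (essSupBall_le huL' x₀ htr ?_)
  filter_upwards [ae_restrict_of_ae hae, ae_restrict_mem measurableSet_ball] with y hy hyb
  have hd : ‖y - x₀‖ ≤ r * t := (mem_ball_iff_norm.1 hyb).le
  have hbar : barrier κ r x₀ y ≤ M := by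
    unfold barrier
    rw [div_le_iff₀ (by positivity)]
    calc κ * ‖y - x₀‖ ^ 2 ≤ κ * (r * t) ^ 2 := by gcongr
      _ = κ * t * t * r ^ 2 := by ring
      _ ≤ M * r ^ 2 := by
          gcongr
          nlinarith [mul_nonneg hκ0 ht0.le]
  linarith

end LebesguePoints

end MixedPLaplace

theorem corollary9p3 {n : ℕ} (hn : 1 ≤ n) (p s Λ : ℝ) (hp : 1 < p) (hs0 : 0 < s) (hs1 : s < 1)
    (hΛ : 1 ≤ Λ) (Ω : Set (MixedPLaplace.Eucl n)) (hΩo : IsOpen Ω) (hΩc : IsConnected Ω)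
    (hΩb : Bornology.IsBounded Ω)
    (K : MixedPLaplace.Eucl n → MixedPLaplace.Eucl n → ℝ) (hK : MixedPLaplace.IsKernel p s Λ K)
    (u : MixedPLaplace.Eucl n → ℝ) (hu : MixedPLaplace.IsWeakSubsolution p K Ω u) :
    (∀ x ∈ Ω, Tendsto (MixedPLaplace.essSupBall u x) (𝓝[>] 0) (𝓝 (MixedPLaplace.uscReg u x))) ∧
    (∀ x ∈ MixedPLaplace.lebesguePoints Ω u, u x = MixedPLaplace.uscReg u x) ∧
    UpperSemicontinuousOn (MixedPLaplace.uscReg u) Ω ∧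
    MixedPLaplace.uscReg u =ᵐ[volume.restrict Ω] u := by
  open MixedPLaplace in
  obtain ⟨v, L, hvm, hvL, huv⟩ := exists_measurable_bounded_ae_eq hu.memLp_top
  have huL : ∀ᵐ x, |u x| ≤ L := huv.mono fun x hx => by rw [hx]; exact hvL x
  have hleb : ∀ x ∈ lebesguePoints Ω u, u x = uscReg u x := by
    rintro x ⟨hxΩ, hx⟩
    refine le_antisymm (le_uscReg_of_tendsto_average hu.memLp_top.1 huL hx) ?_
    rw [uscReg_congr huv]
    -- The level `l` is the value `u x`, not `v x`: only averages and `uscReg` are transferred to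
    -- `v`, so the pointwise value of `u` is kept.
    refine uscReg_le_of_tendsto_average hn hp hs0 hs1 (by linarith) hΩo hK hvm hvL (hu.congr huv)
      hxΩ (hx.congr fun r => ?_)
    rw [setAverage_eq, setAverage_eq]
    congr 1
    refine integral_congr_ae ?_
    filter_upwards [ae_restrict_of_ae huv] with y hy
    rw [hy]
  refine ⟨fun x _ => tendsto_essSupBall_uscReg huL x, hleb,
    (upperSemicontinuous_uscReg huL).upperSemicontinuousOn Ω, ?_⟩
  have hloc : LocallyIntegrable u volume := hu.memLp_top.locallyIntegrable le_top
  filter_upwards [ae_restrict_of_ae (ae_tendsto_average_ball hn hloc),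
    ae_restrict_mem hΩo.measurableSet] with x hx hxΩ
  exact (hleb x ⟨hxΩ, hx⟩).symm
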